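/- Let $D\subset\mathbb R^2$ be a bounded open set, where $\mathbb R^2$ is identified with $\mathbb R^2\times\{0\}=\partial\mathbb R^3_+$, $\mathbb R^3_+=\mathbb R^2\times(0,\infty)$, and let $U\subset\mathbb R^3_+$ be open and bounded with $\{x' : (x',x_3)\in U\}\cap D=\emptyset$. Let $\lambda$ be a centered real-valued generalized Gaussian random field on $\mathbb R^2$ (a random distribution), almost surely supported in $\overline D$, which is microlocally anisotropic of order $\epsilon>0$ in $D$: its covariance operator is a classical pseudodifferential operator with principal symbol $b(x,\xi/|\xi|)\,|\xi|^{-2\epsilon-2}$, where $b\in C^\infty(\mathbb R^2\times\mathbb S^1)$ is real-valued, bounded and vanishes for $x\notin\overline D$. Let $p>\epsilon+\frac12$ and $\lambda_k=k^{-p}\lambda$ for $k\ge 1$. Put $g_k(x)=\frac{e^{ik|x|}}{4\pi|x|}$, $\widetilde x=(x_1,x_2,-x_3)$, $u_{in}(x;y,k)=g_k(x-y)+g_k(\widetilde x-y)$ and $$S_k\phi(x)=\int_D g_k(x-z)\phi(z)\,dz ,$$ and write $S_k^+$ and $S_k^B$ for the restrictions of $S_k\phi$ to $\mathbb R^3_+$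 and to $\mathbb R^2$, respectively. For $y\in U$ define $$\phi_1=2\lambda_k u_{in}(\cdot;y,k),\qquad \phi_{n+1}=2\lambda_k S_k^B\phi_n,\qquad u_n(\cdot;y,k)=S_k^+\phi_n\qquad(n\ge1).$$ Then there are finite real random variables $C_1,C_2$ and $k_0\ge1$ such that for almost every $\omega$ the realization $\lambda(\omega)$ is a continuous function and the following holds. (i) For all $k\ge1$, $y\in U$ and $n\ge1$ we have $\phi_n\in L^2(D)$, and $$|u_n(x;y,k)|\le C_1(\omega)\,C_2(\omega)^{n-1}\,k^{-\frac{n-1}2-np}\qquad\text{for all }x,y\in U .$$ (ii) For all real $k\ge k_0(\omega)$ and all $y\in U$ the equation $$\left(\tfrac12-\lambda_kS_k^B\right)\phi=\lambda_ku_{in}(\cdot;y,k)$$ has a unique solution $\phi\in L^2(D)$, and for every $x\in U$ the series $\sum_{n\ge1}u_n(x;y,k)$ converges to $S_k^+\phi(x)$. Hence, for $x\ne y$, the Born series $u_{in}+u_1+u_2+\cdots$ converges at $(x;y,k)$ to the function $u=u_{in}+S_k^+\phi$. -/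

import Mathlib

open MeasureTheory ProbabilityTheory TopologicalSpace
open scoped Distributions

noncomputable section

namespace HalfSpaceScattering

/-- The plane `ℝ²`, identified with the boundary `ℝ² × {0}` of the half-space. -/
abbrev Plane := EuclideanSpace ℝ (Fin 2)

/-- The space `ℝ³`. -/
abbrev Space := EuclideanSpace ℝ (Fin 3)

/-- The open upper half-space `x₃ > 0`. -/
def upperHalfSpace : Set Space := {x | 0 < x 2}

/-- The boundary point `(z₁, z₂, 0)` of the half-space. -/
def toBoundary (z : Plane) : Space := !₂[z 0, z 1, 0]

/-- The orthogonal projection `x ↦ x' = (x₁, x₂)` to the boundary. -/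
def proj (x : Space) : Plane := !₂[x 0, x 1]

/-- The mirror image `(x₁, x₂, -x₃)`. -/
def reflect (x : Space) : Space := !₂[x 0, x 1, -x 2]

/-! ### Pseudodifferential operators on the plane -/

/-- The Fourier transform `ψ̂(ξ) = ∫ exp(-i x·ξ) ψ(x) dx`. -/
def fourierHat (ψ : Plane → ℝ) (ξ : Plane) : ℂ :=
  ∫ x, Complex.exp (-(Complex.I * (inner ℝ x ξ : ℝ))) * (ψ x : ℂ)

/-- The operator with symbol `σ`:
`(Op(σ) ψ)(x) = (2π)⁻² ∫ exp(i x·ξ) σ(x, ξ) ψ̂(ξ) dξ`. -/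
def opOfSymbol (σ : Plane → Plane → ℂ) (ψ : Plane → ℝ) (x : Plane) : ℂ :=
  (1 / (2 * Real.pi) ^ 2 : ℝ) *
    ∫ ξ, Complex.exp (Complex.I * (inner ℝ x ξ : ℝ)) * σ x ξ * fourierHat ψ ξ

/-- The symbol estimates of order `m`, for frequencies in `s`:
`|∂ₓ^β ∂_ξ^α a(x, ξ)| ≤ C_{α,β} (1 + |ξ|)^(m - |α|)`, where `|β| = i` and `|α| = j`. -/
def SymbolBoundOn (s : Set Plane) (m : ℝ) (a : Plane → Plane → ℂ) : Prop :=
  ∀ i j : ℕ, ∃ C : ℝ, ∀ x : Plane, ∀ ξ ∈ s,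
    ‖iteratedFDeriv ℝ i (fun x' => iteratedFDeriv ℝ j (a x') ξ) x‖ ≤ C * (1 + ‖ξ‖) ^ (m - j)

/-- The symbol class `S^m_{1,0}(ℝ² × ℝ²)`. -/
def IsSymbol (m : ℝ) (a : Plane → Plane → ℂ) : Prop :=
  ContDiff ℝ (⊤ : ℕ∞) (Function.uncurry a) ∧ SymbolBoundOn Set.univ m a

/-- `σ` is a classical (polyhomogeneous) symbol of order `m` with principal symbol `τ₀`: there is
an asymptotic expansion `σ ∼ τ₀ + τ₁ + ⋯` into terms `τⱼ(x, ξ)` that are smooth for `ξ ≠ 0` and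
homogeneous of degree `m - j` in `ξ`. As `σ` itself is a symbol, the remainder estimates only have
to be imposed for `|ξ| ≥ 1`, which replaces the cut-off of `τⱼ` near `ξ = 0`. -/
def IsClassicalSymbol (m : ℝ) (σ τ₀ : Plane → Plane → ℂ) : Prop :=
  IsSymbol m σ ∧
  ∃ τ : ℕ → Plane → Plane → ℂ,
    (∀ x ξ, ξ ≠ 0 → τ 0 x ξ = τ₀ x ξ) ∧
    (∀ j, ContDiffOn ℝ (⊤ : ℕ∞) (Function.uncurry (τ j)) {z | z.2 ≠ 0}) ∧
    (∀ (j : ℕ) (x ξ : Plane) (t : ℝ), ξ ≠ 0 → 0 < t →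
      τ j x (t • ξ) = ((t ^ (m - j) : ℝ) : ℂ) * τ j x ξ) ∧
    ∀ N : ℕ, SymbolBoundOn {ξ | 1 ≤ ‖ξ‖} (m - N)
      (fun x ξ => σ x ξ - ∑ j ∈ Finset.range N, τ j x ξ)

/-! ### Random fields -/

/-- A real-valued generalized Gaussian random field on the plane: a measurable random
distribution, all of whose finite-dimensional marginals `(⟨lam, φ₁⟩, …, ⟨lam, φₘ⟩)` are
Gaussian. -/
structure IsGaussianField {Ω : Type*} [MeasurableSpace Ω] (P : Measure Ω)
    (lam : Ω → 𝓓'((⊤ : Opens Plane), ℝ)) : Prop where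
  measurable : ∀ φ : 𝓓((⊤ : Opens Plane), ℝ), Measurable (fun ω => lam ω φ)
  gaussian : IsGaussianProcess (fun (φ : 𝓓((⊤ : Opens Plane), ℝ)) ω => lam ω φ) P

/-- The covariance operator `C` of `lam`, given by
`⟨ψ₁, C ψ₂⟩ = 𝔼((⟨lam, ψ₁⟩ - 𝔼⟨lam, ψ₁⟩)(⟨lam, ψ₂⟩ - 𝔼⟨lam, ψ₂⟩))`,
is the pseudodifferential operator with symbol `σ`. -/
def HasCovarianceSymbol {Ω : Type*} [MeasurableSpace Ω] (P : Measure Ω)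
    (lam : Ω → 𝓓'((⊤ : Opens Plane), ℝ)) (σ : Plane → Plane → ℂ) : Prop :=
  ∀ ψ₁ ψ₂ : 𝓓((⊤ : Opens Plane), ℝ),
    ((cov[fun ω => lam ω ψ₁, fun ω => lam ω ψ₂; P] : ℝ) : ℂ) =
      ∫ x, (ψ₁ x : ℂ) * opOfSymbol σ ψ₂ x

/-- `lam` is microlocally anisotropic of order `ε` in `D`: its covariance operator is a classical
pseudodifferential operator with principal symbol `b(x, ξ/|ξ|) / |ξ|^(2ε+2)`, where the bounded
function `b` is smooth on `ℝ² × S¹` and supported in `D × S¹`. Only the values of `b` at unit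
vectors matter; smoothness on `ℝ² × S¹` is that of the extension of degree zero. -/
def IsMicrolocallyAnisotropic {Ω : Type*} [MeasurableSpace Ω] (P : Measure Ω)
    (lam : Ω → 𝓓'((⊤ : Opens Plane), ℝ)) (ε : ℝ) (D : Set Plane) : Prop :=
  ∃ (b : Plane → Plane → ℝ) (σ : Plane → Plane → ℂ),
    ContDiffOn ℝ (⊤ : ℕ∞) (fun z : Plane × Plane => b z.1 (‖z.2‖⁻¹ • z.2)) {z | z.2 ≠ 0} ∧
    (∃ M : ℝ, ∀ x θ, ‖θ‖ = 1 → |b x θ| ≤ M) ∧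
    (∀ x θ, ‖θ‖ = 1 → x ∉ closure D → b x θ = 0) ∧
    IsClassicalSymbol (-2 * ε - 2) σ
      (fun x ξ => ((b x (‖ξ‖⁻¹ • ξ) / ‖ξ‖ ^ (2 * ε + 2) : ℝ) : ℂ)) ∧
    HasCovarianceSymbol P lam σ

/-- The distribution `T` is the continuous function `ℓ`. -/
def IsContinuousRepresentative (T : 𝓓'((⊤ : Opens Plane), ℝ)) (ℓ : Plane → ℝ) : Prop :=
  Continuous ℓ ∧ ∀ φ : 𝓓((⊤ : Opens Plane), ℝ), T φ = ∫ z, ℓ z * φ z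

/-! ### The forward problem -/

/-- The outgoing fundamental solution `g_k(x) = exp(ik|x|) / (4π|x|)`. -/
def g (k : ℝ) (x : Space) : ℂ :=
  Complex.exp (Complex.I * (k * ‖x‖ : ℝ)) / ((4 * Real.pi * ‖x‖ : ℝ) : ℂ)

/-- The incident field `u_in(x; y, k) = g_k(x - y) + g_k(x̃ - y)`. -/
def uIn (k : ℝ) (x y : Space) : ℂ := g k (x - y) + g k (reflect x - y)

/-- The impedance `λ_k = λ / k^p`, for a realization `ℓ` of `λ`. -/
def impedance (ℓ : Plane → ℝ) (p k : ℝ) (z : Plane) : ℂ := ((ℓ z / k ^ p : ℝ) : ℂ)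

/-- The single layer potential `S_k φ(x) = ∫_D g_k(x - z) φ(z) dz` at `x ∈ ℝ³` of a density on
`D` (extended by zero to the boundary plane). -/
def singleLayer (D : Set Plane) (k : ℝ) (φ : Plane → ℂ) (x : Space) : ℂ :=
  ∫ z in D, g k (x - toBoundary z) * φ z

/-- The boundary operator `S_k^B`. -/
def singleLayerBoundary (D : Set Plane) (k : ℝ) (φ : Plane → ℂ) (z : Plane) : ℂ :=
  singleLayer D k φ (toBoundary z)

/-- The boundary integral equation `(1/2 - λ_k S_k^B) φ = λ_k u_in(·; y, k)` in `L²(D)`. -/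
def SolvesBoundaryEquation (D : Set Plane) (ℓ : Plane → ℝ) (p k : ℝ) (y : Space)
    (φ : Lp ℂ 2 (volume.restrict D)) : Prop :=
  ∀ᵐ z ∂(volume.restrict D),
    (1 / 2 : ℂ) * φ z - impedance ℓ p k z * singleLayerBoundary D k φ z
      = impedance ℓ p k z * uIn k (toBoundary z) y

/-- The densities of the Born series, numbered from zero: `bornDensity … n` is `φ_{n+1}`, where
`φ₁ = 2 λ_k u_in` and `φ_{n+1} = 2 λ_k S_k^B φ_n`. -/
def bornDensity (D : Set Plane) (ℓ : Plane → ℝ) (p k : ℝ) (y : Space) : ℕ → Plane → ℂ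
  | 0 => fun z => 2 * impedance ℓ p k z * uIn k (toBoundary z) y
  | n + 1 => fun z =>
      2 * impedance ℓ p k z * singleLayerBoundary D k (bornDensity D ℓ p k y n) z

/-- The terms of the Born series: `u_in`, and `u_n = S_k^+ φ_n` for `n ≥ 1`. -/
def bornTerm (D : Set Plane) (ℓ : Plane → ℝ) (p k : ℝ) (x y : Space) : ℕ → ℂ
  | 0 => uIn k x y
  | n + 1 => singleLayer D k (bornDensity D ℓ p k y n) x

end HalfSpaceScattering

end

open HalfSpaceScattering

/-! The proof joins a deterministic estimate for a bounded, Hölder continuous impedance with the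
almost sure Hölder regularity of λ.

Operator norm. With T = 2λ_k S_k^B and f = 2λ_k u_in the boundary equation reads (1 - T)φ = f, and
φ_{n+1} = T^n f. On the bounded set D, S_k^B is convolution with g_k cut off at a distance R beyond
the diameter. In polar coordinates the Jacobian cancels the singularity 1/r, and the Fourier
transform of the cut-off kernel becomes an angular average of ∫₀^R exp(ir(k - a cos θ)) dr. The
phase vanishes at most quadratically in the angle, so the average is O((R/k)^{1/2}) uniformly in a
(`integral_norm_integral_exp_le`). By Plancherel ‖S_k^B‖ = O(k^{-1/2})
(`exists_singleLayerBoundary_clm`), hence ‖T‖ = O(k^{-p-1/2}), and the Neumann series converges for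
large k.

Pointwise bounds. U may reach the boundary plane, where the bound |z - x'|^{-2} for |g_k(x - z)|²
just fails to be integrable in z. But proj U is open, hence disjoint from the closure of D, so λ
vanishes at x'. By Hölder continuity |λ||g_k|² is at most a multiple of |z - x'|^{γ-2}, which is
integrable uniformly in x (`integral_weight_mul_norm_g_sq_le`). Writing |λ| as a product of two
square roots, one for each adjacent factor, Cauchy–Schwarz bounds every u_n (`exists_born_operator`,
`born_series_of_holder`).

Regularity of λ. The covariance symbol has order -2ε-2 < -2, so the covariance kernel is an
absolutely convergent integral, Hölder continuous in its second variable
(`exists_covKernel_holder`). Thus λ tested against the difference of two bumps of scale about 2^{-n}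
at distance O(2^{-n}) has variance O(2^{-4γn}). High Gaussian moments beat the O(4^n) grid points,
and dyadic chaining produces a Hölder function ℓ with measurable constants
(`exists_ae_forall_abs_le`, `exists_holder_limit`). That λ = ℓ is checked almost surely on a
countable determining set of test functions (`exists_ae_holder_representative`). -/

/-! ### Convolution operators on L² as Fourier multipliers. -/

section FourierMultiplier

open SchwartzMap FourierTransform
open scoped ENNReal Convolution

variable {E : Type*} [NormedAddCommGroup E] [InnerProductSpace ℝ E] [FiniteDimensional ℝ E]
  [MeasurableSpace E] [BorelSpace E]

theorem integral_mul_fourier_eq {u : E → ℂ} (hu : Integrable u) (g : 𝓢(E, ℂ)) :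
    ∫ x, (𝓕 g) x * u x = ∫ x, g x * 𝓕 u x := by
  have h := VectorFourier.integral_fourierIntegral_smul_eq_flip (μ := (volume : Measure E))
    (ν := (volume : Measure E)) (L := innerₗ E) (f := u) (g := (g : E → ℂ))
    Real.continuous_fourierChar continuous_inner hu g.integrable
  rw [flip_innerₗ] at h
  simp only [smul_eq_mul] at h
  calc ∫ x, (𝓕 g) x * u x
      = ∫ x, u x * VectorFourier.fourierIntegral Real.fourierChar volume (innerₗ E) g x := by
        congr 1 with x
        rw [mul_comm, SchwartzMap.fourier_coe]
        rfl
    _ = _ := by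
        rw [← h]
        congr 1 with x
        rw [mul_comm]
        rfl

theorem Lp_integral_mul_fourier_eq (h : Lp ℂ 2 (volume : Measure E)) (g : 𝓢(E, ℂ)) :
    ∫ x, (𝓕 g) x * h x = ∫ x, g x * (𝓕 h : Lp ℂ 2 (volume : Measure E)) x := by
  have := congrArg (fun T => T g) (Lp.fourier_toTemperedDistribution_eq h)
  simpa [TemperedDistribution.fourier_apply, Lp.toTemperedDistribution_apply] using this

/-- Smooth compactly supported functions are Schwartz, so the fundamental lemma applies. This
reconciles the Fourier integral with the L² transform: both satisfy the same duality with Schwartz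
functions. -/
theorem ae_eq_of_integral_schwartz_mul_eq {u v : E → ℂ} (hu : LocallyIntegrable u)
    (hv : LocallyIntegrable v)
    (hui : ∀ g : 𝓢(E, ℂ), Integrable (fun x => g x * u x))
    (hvi : ∀ g : 𝓢(E, ℂ), Integrable (fun x => g x * v x))
    (h : ∀ g : 𝓢(E, ℂ), ∫ x, g x * u x = ∫ x, g x * v x) : u =ᵐ[volume] v := by
  have := ae_eq_zero_of_integral_contDiff_smul_eq_zero (μ := (volume : Measure E)) (hu.sub hv) ?_
  · filter_upwards [this] with x hx
    simpa [sub_eq_zero] using hx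
  · intro g hg hgc
    have hgc' : HasCompactSupport (fun x => (g x : ℂ)) := hgc.comp_left (g := ((↑) : ℝ → ℂ)) rfl
    have hg' : ContDiff ℝ (⊤ : ℕ∞) (fun x => (g x : ℂ)) := Complex.ofRealCLM.contDiff.comp hg
    have hh := h (hgc'.toSchwartzMap hg')
    have h1 := hui (hgc'.toSchwartzMap hg')
    have h2 := hvi (hgc'.toSchwartzMap hg')
    simp only [HasCompactSupport.toSchwartzMap_toFun] at hh h1 h2
    simp only [Pi.sub_apply, smul_sub, Complex.real_smul]
    rw [integral_sub h1 h2, hh, sub_self]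

theorem SchwartzMap.integrable_mul_memLp_two (g : 𝓢(E, ℂ)) {h : E → ℂ} (hh : MemLp h 2) :
    Integrable (fun x => g x * h x) :=
  (g.memLp 2 volume).integrable_mul hh

theorem SchwartzMap.integrable_mul_integrable (g : 𝓢(E, ℂ)) {h : E → ℂ} (hh : Integrable h) :
    Integrable (fun x => g x * h x) :=
  hh.bdd_mul g.continuous.aestronglyMeasurable
    (Filter.Eventually.of_forall fun x => g.norm_le_seminorm ℝ x)

theorem SchwartzMap.integrable_mul_fourier (g : 𝓢(E, ℂ)) {h : E → ℂ} (hh : Integrable h) :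
    Integrable (fun x => g x * 𝓕 h x) := by
  have hc : Continuous (𝓕 h) := VectorFourier.fourierIntegral_continuous
    Real.continuous_fourierChar continuous_inner hh
  refine g.integrable.mul_bdd (c := ∫ x, ‖h x‖) hc.aestronglyMeasurable ?_
  exact Filter.Eventually.of_forall fun x => VectorFourier.norm_fourierIntegral_le_integral_norm _ _ _ _ _

theorem continuous_fourier_of_integrable {h : E → ℂ} (hh : Integrable h) : Continuous (𝓕 h) :=
  VectorFourier.fourierIntegral_continuous Real.continuous_fourierChar continuous_inner hh

/-- The `L²` Fourier transform of an integrable function is given by the Fourier integral. -/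
theorem coeFn_fourier_toLp {f : E → ℂ} (hf : Integrable f) (hf2 : MemLp f 2) :
    ((𝓕 (hf2.toLp f) : Lp ℂ 2 (volume : Measure E)) : E → ℂ) =ᵐ[volume] 𝓕 f := by
  refine ae_eq_of_integral_schwartz_mul_eq
    ((Lp.memLp _).locallyIntegrable (by norm_num))
    (continuous_fourier_of_integrable hf).locallyIntegrable
    (fun g => g.integrable_mul_memLp_two (Lp.memLp _)) (fun g => g.integrable_mul_fourier hf) ?_
  intro g
  rw [← Lp_integral_mul_fourier_eq, ← integral_mul_fourier_eq hf]
  refine integral_congr_ae ?_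
  filter_upwards [hf2.coeFn_toLp] with x hx
  rw [hx]

/-- Convolution with an integrable kernel `K` is bounded on `L²` by any bound of `𝓕 K`. -/
theorem eLpNorm_convolution_le_of_norm_fourier_le {K f : E → ℂ} (hK : Integrable K)
    (hf : Integrable f) (hf2 : MemLp f 2) {B : ℝ} (hB : ∀ ξ, ‖𝓕 K ξ‖ ≤ B) :
    MemLp (K ⋆[ContinuousLinearMap.mul ℂ ℂ] f) 2 ∧
    eLpNorm (K ⋆[ContinuousLinearMap.mul ℂ ℂ] f) 2 volume
      ≤ ENNReal.ofReal B * eLpNorm f 2 volume := by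
  have hKf : Integrable (K ⋆[ContinuousLinearMap.mul ℂ ℂ] f) :=
    hK.integrable_convolution (ContinuousLinearMap.mul ℂ ℂ) hf
  have hFm : AEStronglyMeasurable (𝓕 (K ⋆[ContinuousLinearMap.mul ℂ ℂ] f)) volume :=
    (continuous_fourier_of_integrable hKf).aestronglyMeasurable
  have hF : 𝓕 (K ⋆[ContinuousLinearMap.mul ℂ ℂ] f) = fun ξ => 𝓕 K ξ * 𝓕 f ξ := by
    ext ξ
    exact Real.fourier_mul_convolution_eq hK hf ξ
  set L : Lp ℂ 2 (volume : Measure E) := 𝓕 (hf2.toLp f) with hL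
  have hLf := coeFn_fourier_toLp hf hf2
  have hbound : ∀ᵐ ξ, ‖𝓕 (K ⋆[ContinuousLinearMap.mul ℂ ℂ] f) ξ‖ ≤ B * ‖L ξ‖ := by
    filter_upwards [hLf] with ξ hξ
    rw [hF, hL, hξ, norm_mul]
    exact mul_le_mul_of_nonneg_right (hB ξ) (norm_nonneg _)
  have hF2 : MemLp (𝓕 (K ⋆[ContinuousLinearMap.mul ℂ ℂ] f)) 2 :=
    MemLp.of_le_mul (Lp.memLp L) hFm hbound
  have hnF : eLpNorm (𝓕 (K ⋆[ContinuousLinearMap.mul ℂ ℂ] f)) 2 volume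
      ≤ ENNReal.ofReal B * eLpNorm L 2 volume :=
    eLpNorm_le_mul_eLpNorm_of_ae_le_mul hbound 2
  set h : Lp ℂ 2 (volume : Measure E) := 𝓕⁻ (hF2.toLp _) with hh
  have hFh : (𝓕 h : Lp ℂ 2 (volume : Measure E)) = hF2.toLp _ := by
    rw [hh, FourierTransform.fourier_fourierInv_eq]
  have key : K ⋆[ContinuousLinearMap.mul ℂ ℂ] f =ᵐ[volume] h := by
    -- The convolution, known only to be integrable, and the L² function `h` have the same Fourier
    -- transform; writing each test function as a transform moves 𝓕 onto them.
    refine ae_eq_of_integral_schwartz_mul_eq hKf.locallyIntegrable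
      ((Lp.memLp _).locallyIntegrable (by norm_num))
      (fun g => g.integrable_mul_integrable hKf) (fun g => g.integrable_mul_memLp_two (Lp.memLp _)) ?_
    intro g
    have hg : g = 𝓕 (𝓕⁻ g) := by rw [FourierTransform.fourier_fourierInv_eq]
    rw [hg, integral_mul_fourier_eq hKf, Lp_integral_mul_fourier_eq, hFh]
    refine integral_congr_ae ?_
    filter_upwards [hF2.coeFn_toLp] with x hx
    rw [hx]
  refine ⟨(memLp_congr_ae key).2 (Lp.memLp h), ?_⟩
  rw [eLpNorm_congr_ae key]
  have e1 : eLpNorm h 2 volume = eLpNorm (𝓕 (K ⋆[ContinuousLinearMap.mul ℂ ℂ] f)) 2 volume := by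
    have : ‖h‖ = ‖hF2.toLp _‖ := by rw [← hFh, Lp.norm_fourier_eq]
    rw [Lp.norm_def, Lp.norm_toLp] at this
    exact (ENNReal.toReal_eq_toReal_iff' (Lp.eLpNorm_ne_top h) hF2.eLpNorm_ne_top).1 this
  have e2 : eLpNorm L 2 volume = eLpNorm f 2 volume := by
    have : ‖L‖ = ‖hf2.toLp f‖ := by rw [hL, Lp.norm_fourier_eq]
    rw [Lp.norm_def, Lp.norm_toLp] at this
    exact (ENNReal.toReal_eq_toReal_iff' (Lp.eLpNorm_ne_top L) hf2.eLpNorm_ne_top).1 this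
  rw [e1, ← e2]
  exact hnF

end FourierMultiplier

/-! ### Angular averages of oscillatory integrals. -/

section OscillatoryIntegrals

theorem norm_integral_exp_mul_I_mul_abs_le (R v : ℝ) :
    ‖∫ r in (0 : ℝ)..R, Complex.exp (Complex.I * (r * v : ℝ))‖ * |v| ≤ 2 := by
  rcases eq_or_ne v 0 with rfl | hv
  · simp
  have hc : Complex.I * v ≠ 0 := mul_ne_zero Complex.I_ne_zero (by exact_mod_cast hv)
  have e : ∀ r : ℝ, Complex.exp (Complex.I * (r * v : ℝ)) = Complex.exp (Complex.I * v * r) := by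
    intro r
    congr 1
    push_cast
    ring
  simp_rw [e]
  rw [integral_exp_mul_complex hc, norm_div]
  have hn : ‖Complex.I * (v : ℂ)‖ = |v| := by simp
  rw [hn, div_mul_cancel₀ _ (abs_ne_zero.2 hv)]
  refine (norm_sub_le _ _).trans ?_
  rw [← e, ← e]
  simp only [mul_comm Complex.I, Complex.norm_exp_ofReal_mul_I]
  norm_num

theorem norm_integral_exp_mul_I_le {R : ℝ} (hR : 0 ≤ R) (v : ℝ) :
    ‖∫ r in (0 : ℝ)..R, Complex.exp (Complex.I * (r * v : ℝ))‖ ≤ R := by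
  have := intervalIntegral.norm_integral_le_of_norm_le_const (a := 0) (b := R) (C := 1)
    (f := fun r : ℝ => Complex.exp (Complex.I * (r * v : ℝ)))
    (fun x _ => by rw [mul_comm Complex.I, Complex.norm_exp_ofReal_mul_I])
  simpa [abs_of_nonneg hR] using this

/-- Adding the trivial bound N ≤ R and the oscillatory bound N|v| ≤ 2, suitably weighted, gives one
Lorentzian in t, which can be integrated exactly. -/
theorem norm_integral_exp_mul_I_le_div {R b t v : ℝ} (hR : 0 < R) (hb : 0 < b)
    (hv : 2 * t ^ 2 ≤ |v| * b) :
    ‖∫ r in (0 : ℝ)..R, Complex.exp (Complex.I * (r * v : ℝ))‖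
      ≤ 2 * R * b / (R * t ^ 2 + b) := by
  have h1 := norm_integral_exp_mul_I_mul_abs_le R v
  have h2 := norm_integral_exp_mul_I_le hR.le v
  set N := ‖∫ r in (0 : ℝ)..R, Complex.exp (Complex.I * (r * v : ℝ))‖
  have hN : 0 ≤ N := norm_nonneg _
  rw [le_div_iff₀ (by positivity)]
  have h3 : N * R * (2 * t ^ 2) ≤ N * R * (|v| * b) := by gcongr
  have h4 : (N * |v|) * (R * b) ≤ 2 * (R * b) := by gcongr
  have h5 : N * b ≤ R * b := by gcongr
  nlinarith

theorem integral_div_mul_sq_add {R b : ℝ} (hR : 0 < R) (hb : 0 < b) (t₀ : ℝ) :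
    Integrable (fun t : ℝ => 2 * R * b / (R * (t - t₀) ^ 2 + b)) ∧
    ∫ t : ℝ, 2 * R * b / (R * (t - t₀) ^ 2 + b) = 2 * Real.pi * Real.sqrt (R * b) := by
  have hc : 0 < Real.sqrt (R / b) := Real.sqrt_pos.2 (by positivity)
  have hc2 : Real.sqrt (R / b) ^ 2 = R / b := Real.sq_sqrt (by positivity)
  have e : ∀ t : ℝ, 2 * R * b / (R * (t - t₀) ^ 2 + b)
      = 2 * R * (fun s : ℝ => (1 + (Real.sqrt (R / b) * s) ^ 2)⁻¹) (t - t₀) := by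
    intro t
    simp only [mul_pow, hc2]
    have : R * (t - t₀) ^ 2 + b ≠ 0 := by positivity
    have : 1 + R / b * (t - t₀) ^ 2 ≠ 0 := by positivity
    field_simp
    ring
  simp_rw [e]
  have hi : Integrable (fun s : ℝ => (1 + (Real.sqrt (R / b) * s) ^ 2)⁻¹) :=
    integrable_inv_one_add_sq.comp_mul_left' hc.ne'
  refine ⟨(hi.comp_sub_right t₀).const_mul _, ?_⟩
  rw [integral_const_mul, integral_sub_right_eq_self (fun s : ℝ => (1 + (Real.sqrt (R / b) * s) ^ 2)⁻¹) t₀,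
    Measure.integral_comp_mul_left (fun s : ℝ => (1 + s ^ 2)⁻¹), integral_univ_inv_one_add_sq,
    abs_of_pos (inv_pos.2 hc), smul_eq_mul]
  have : Real.sqrt (R * b) = R * (Real.sqrt (R / b))⁻¹ := by
    rw [← Real.sqrt_inv, ← Real.sqrt_sq hR.le, ← Real.sqrt_mul (by positivity)]
    congr 1
    rw [Real.sqrt_sq hR.le]
    field_simp
  rw [this]
  ring

/-- For t ≤ s the difference is, up to sign, 2 sin((s+t)/2) sin((s-t)/2). The second sine is at
least (s-t)/π by Jordan's inequality, and the first is at least as large as the second. -/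
theorem sq_sub_le_abs_cos_sub_cos {s t : ℝ} (hs : s ∈ Set.Icc 0 Real.pi)
    (ht : t ∈ Set.Icc 0 Real.pi) :
    2 * (s - t) ^ 2 / Real.pi ^ 2 ≤ |Real.cos s - Real.cos t| := by
  wlog h : t ≤ s generalizing s t
  · have := this ht hs (le_of_not_ge h)
    rwa [abs_sub_comm, show (s - t) ^ 2 = (t - s) ^ 2 by ring]
  have hpi := Real.pi_pos
  rw [Real.cos_sub_cos, abs_mul, abs_mul]
  obtain ⟨hs0, hs1⟩ := hs
  obtain ⟨ht0, ht1⟩ := ht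
  have hd : (s - t) / Real.pi ≤ Real.sin ((s - t) / 2) := by
    have := Real.mul_le_sin (x := (s - t) / 2) (by linarith) (by linarith)
    calc (s - t) / Real.pi = 2 / Real.pi * ((s - t) / 2) := by ring
      _ ≤ _ := this
  have hd0 : 0 ≤ (s - t) / Real.pi := by have := sub_nonneg.2 h; positivity
  have hd2 : Real.sin ((s - t) / 2) ≤ Real.sin ((s + t) / 2) := by
    rw [← sub_nonneg, Real.sin_sub_sin]
    have e1 : ((s + t) / 2 - (s - t) / 2) / 2 = t / 2 := by ring
    have e2 : ((s + t) / 2 + (s - t) / 2) / 2 = s / 2 := by ring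
    rw [e1, e2]
    have := Real.sin_nonneg_of_nonneg_of_le_pi (x := t / 2) (by linarith) (by linarith)
    have := Real.cos_nonneg_of_mem_Icc (x := s / 2) ⟨by linarith, by linarith⟩
    positivity
  rw [abs_of_nonneg (hd0.trans (hd.trans hd2)), abs_of_nonneg (hd0.trans hd)]
  calc 2 * (s - t) ^ 2 / Real.pi ^ 2 = 2 * ((s - t) / Real.pi) * ((s - t) / Real.pi) := by ring
    _ ≤ |(-2 : ℝ)| * Real.sin ((s + t) / 2) * Real.sin ((s - t) / 2) := by
      rw [show |(-2 : ℝ)| = 2 by norm_num]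
      have h1 := hd.trans hd2
      have h2 := hd0.trans h1
      gcongr

/-- The phase `k - a cos s` degenerates at most quadratically at one angle. -/
theorem exists_sq_le_abs_sub_mul_cos {k : ℝ} (hk : 0 < k) {a : ℝ} (ha : 0 ≤ a) :
    ∃ t₀ : ℝ, ∀ s ∈ Set.Icc (0 : ℝ) Real.pi,
      k * (s - t₀) ^ 2 / (2 * Real.pi ^ 2) ≤ |k - a * Real.cos s| := by
  have hpi := Real.pi_pos
  -- Three regimes: for a ≤ k/2 the phase stays above k/2; for a ≥ k it vanishes at arccos(k/a); in
  -- between, k - a cos s ≥ a(1 - cos s) and the reference angle is 0.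
  rcases le_or_gt a (k / 2) with hak | hak
  · refine ⟨0, fun s hs => ?_⟩
    have h1 : a * Real.cos s ≤ k / 2 := by
      have := Real.cos_le_one s
      nlinarith
    have h2 : k * (s - 0) ^ 2 / (2 * Real.pi ^ 2) ≤ k / 2 := by
      rw [div_le_div_iff₀ (by positivity) (by norm_num), sub_zero]
      have : s ^ 2 ≤ Real.pi ^ 2 := pow_le_pow_left₀ hs.1 hs.2 2
      nlinarith
    exact h2.trans ((by linarith : k / 2 ≤ k - a * Real.cos s).trans (le_abs_self _))
  · have ha0 : 0 < a := by linarith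
    have main : ∀ t₀ ∈ Set.Icc (0 : ℝ) Real.pi,
        (∀ s ∈ Set.Icc (0 : ℝ) Real.pi,
          a * |Real.cos s - Real.cos t₀| ≤ |k - a * Real.cos s|) →
        ∃ t₀ : ℝ, ∀ s ∈ Set.Icc (0 : ℝ) Real.pi,
          k * (s - t₀) ^ 2 / (2 * Real.pi ^ 2) ≤ |k - a * Real.cos s| := by
      intro t₀ ht₀ h
      refine ⟨t₀, fun s hs => le_trans ?_ (h s hs)⟩
      have := sq_sub_le_abs_cos_sub_cos hs ht₀
      calc k * (s - t₀) ^ 2 / (2 * Real.pi ^ 2) = k / 2 * ((s - t₀) ^ 2 / Real.pi ^ 2) := by ring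
        _ ≤ a * (2 * ((s - t₀) ^ 2 / Real.pi ^ 2)) := by
          have : 0 ≤ (s - t₀) ^ 2 / Real.pi ^ 2 := by positivity
          nlinarith
        _ ≤ _ := by
          rw [← mul_div_assoc]
          gcongr
    rcases le_or_gt k a with hka | hka
    · refine main (Real.arccos (k / a)) ⟨Real.arccos_nonneg _, Real.arccos_le_pi _⟩ fun s hs => ?_
      rw [Real.cos_arccos (by have : 0 ≤ k / a := by positivity
                              linarith) ((div_le_one ha0).2 hka), abs_sub_comm,
        ← abs_of_pos ha0, ← abs_mul, abs_of_pos ha0, mul_sub, mul_div_cancel₀ _ ha0.ne']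
    · refine main 0 ⟨le_rfl, hpi.le⟩ fun s hs => ?_
      rw [Real.cos_zero, abs_sub_comm, abs_of_nonneg (by linarith [Real.cos_le_one s])]
      refine le_trans ?_ (le_abs_self _)
      nlinarith [Real.cos_le_one s]

/-- Angular average of the truncated oscillatory integrals. -/
theorem integral_norm_integral_exp_le {k R : ℝ} (hk : 0 < k) (hR : 0 < R) {a : ℝ} (ha : 0 ≤ a)
    (φ : ℝ) :
    ∫ θ in Set.Ioo (-Real.pi) Real.pi,
      ‖∫ r in (0 : ℝ)..R, Complex.exp (Complex.I * (r * (k - a * Real.cos (θ - φ)) : ℝ))‖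
      ≤ 8 * Real.pi ^ 2 * Real.sqrt (R / k) := by
  have hpi := Real.pi_pos
  obtain ⟨t₀, ht₀⟩ := exists_sq_le_abs_sub_mul_cos hk ha
  -- This value turns the quadratic lower bound for the phase into the hypothesis 2t² ≤ |v|b of the
  -- Lorentzian bound.
  set b := 4 * Real.pi ^ 2 / k with hb
  have hb0 : 0 < b := by positivity
  set F : ℝ → ℝ := fun s =>
    ‖∫ r in (0 : ℝ)..R, Complex.exp (Complex.I * (r * (k - a * Real.cos s) : ℝ))‖ with hF
  have hFc : Continuous F := by
    refine Continuous.norm ?_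
    apply intervalIntegral.continuous_parametric_intervalIntegral_of_continuous'
    fun_prop
  have hper : Function.Periodic F (2 * Real.pi) := fun s => by
    simp only [hF, Real.cos_add_two_pi]
  set G : ℝ → ℝ → ℝ := fun c s => 2 * R * b / (R * (s - c) ^ 2 + b) with hG
  have hG0 : ∀ c s, 0 ≤ G c s := fun c s => by positivity
  -- The degeneracy is controlled on [0, π] only; since cosine is even, negative angles are governed
  -- by the mirrored centre -t₀.
  have hbound : ∀ s ∈ Set.Ioo (-Real.pi) Real.pi, F s ≤ G t₀ s + G (-t₀) s := by
    intro s hs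
    rcases le_total 0 s with h | h
    · have := norm_integral_exp_mul_I_le_div (R := R) (b := b) (t := s - t₀)
        (v := k - a * Real.cos s) hR hb0 ?_
      · exact this.trans (le_add_of_nonneg_right (hG0 _ _))
      · have := ht₀ s ⟨h, hs.2.le⟩
        calc 2 * (s - t₀) ^ 2 = k * (s - t₀) ^ 2 / (2 * Real.pi ^ 2) * b := by
              rw [hb]; field_simp; ring
          _ ≤ _ := by gcongr
    · have := norm_integral_exp_mul_I_le_div (R := R) (b := b) (t := s - (-t₀))
        (v := k - a * Real.cos s) hR hb0 ?_
      · exact this.trans (le_add_of_nonneg_left (hG0 _ _))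
      · have := ht₀ (-s) ⟨by linarith, by linarith [hs.1]⟩
        rw [Real.cos_neg] at this
        calc 2 * (s - (-t₀)) ^ 2 = k * (-s - t₀) ^ 2 / (2 * Real.pi ^ 2) * b := by
              rw [hb]; field_simp; ring
          _ ≤ _ := by gcongr
  have hshift : ∫ θ in Set.Ioo (-Real.pi) Real.pi, F (θ - φ)
      = ∫ θ in Set.Ioo (-Real.pi) Real.pi, F θ := by
    rw [← integral_Ioc_eq_integral_Ioo, ← integral_Ioc_eq_integral_Ioo,
      ← intervalIntegral.integral_of_le (by linarith), ← intervalIntegral.integral_of_le (by linarith),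
      intervalIntegral.integral_comp_sub_right F φ]
    have := hper.intervalIntegral_add_eq (-Real.pi - φ) (-Real.pi)
    rw [show -Real.pi - φ + 2 * Real.pi = Real.pi - φ by ring,
      show -Real.pi + 2 * Real.pi = Real.pi by ring] at this
    exact this
  obtain ⟨i1, e1⟩ := integral_div_mul_sq_add hR hb0 t₀
  obtain ⟨i2, e2⟩ := integral_div_mul_sq_add hR hb0 (-t₀)
  have hsq : Real.sqrt (R * b) = 2 * Real.pi * Real.sqrt (R / k) := by
    rw [hb, show R * (4 * Real.pi ^ 2 / k) = (2 * Real.pi) ^ 2 * (R / k) by ring,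
      Real.sqrt_mul (by positivity), Real.sqrt_sq (by positivity)]
  calc ∫ θ in Set.Ioo (-Real.pi) Real.pi, F (θ - φ)
      = ∫ θ in Set.Ioo (-Real.pi) Real.pi, F θ := hshift
    _ ≤ ∫ θ in Set.Ioo (-Real.pi) Real.pi, (G t₀ θ + G (-t₀) θ) :=
        setIntegral_mono_on (hFc.integrableOn_Icc.mono_set Set.Ioo_subset_Icc_self)
          (i1.add i2).integrableOn measurableSet_Ioo hbound
    _ ≤ ∫ θ, (G t₀ θ + G (-t₀) θ) :=
        setIntegral_le_integral (i1.add i2)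
          (Filter.Eventually.of_forall fun s => add_nonneg (hG0 _ _) (hG0 _ _))
    _ = 8 * Real.pi ^ 2 * Real.sqrt (R / k) := by
        rw [integral_add i1 i2, e1, e2, hsq]
        ring

end OscillatoryIntegrals

/-! ### The cut-off boundary kernel and its Fourier transform. -/

section TruncatedKernel

open scoped FourierTransform Convolution ENNReal

theorem integrableOn_norm_rpow_ball {s : ℝ} (hs : -2 < s) (R : ℝ) :
    IntegrableOn (fun x : Plane => ‖x‖ ^ s) (Metric.ball 0 R) := by
  rw [integrableOn_fun_norm_addHaar (volume : Measure Plane) (f := fun r => r ^ s)]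
  have h : IntegrableOn (fun y : ℝ => y ^ (s + 1)) (Set.Ioo 0 R) := by
    rcases le_or_gt R 0 with hR | hR
    · simp [Set.Ioo_eq_empty (not_lt.2 hR)]
    · exact (intervalIntegral.integrableOn_Ioo_rpow_iff hR).2 (by linarith)
  refine h.congr_fun (fun y hy => ?_) measurableSet_Ioo
  have hy0 : 0 < y := hy.1
  simp only [finrank_euclideanSpace_fin, smul_eq_mul]
  rw [Real.rpow_add_one hy0.ne', mul_comm]
  norm_num

theorem norm_g (k : ℝ) (x : Space) : ‖g k x‖ = (4 * Real.pi * ‖x‖)⁻¹ := by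
  rw [g, norm_div, mul_comm Complex.I, Complex.norm_exp_ofReal_mul_I, Complex.norm_real,
    Real.norm_of_nonneg (by positivity), one_div]

theorem continuous_toBoundary : Continuous toBoundary := by
  unfold toBoundary
  fun_prop

theorem measurable_g (k : ℝ) : Measurable (g k) := by
  unfold g
  fun_prop

/-- The boundary kernel `g_k` on the plane, cut off at distance `R`. -/
noncomputable def truncatedKernel (k R : ℝ) : Plane → ℂ :=
  (Metric.ball 0 R).indicator fun x => g k (toBoundary x)

theorem norm_toBoundary (z : Plane) : ‖toBoundary z‖ = ‖z‖ := by
  simp [toBoundary, EuclideanSpace.norm_eq, Fin.sum_univ_succ]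

theorem integrable_truncatedKernel (k R : ℝ) : Integrable (truncatedKernel k R) := by
  unfold truncatedKernel
  rw [integrable_indicator_iff measurableSet_ball]
  refine ((integrableOn_norm_rpow_ball (s := -1) (by norm_num) R).const_mul
    ((4 * Real.pi)⁻¹)).mono' ?_ ?_
  · exact ((measurable_g k).comp continuous_toBoundary.measurable).aestronglyMeasurable
  · refine Filter.Eventually.of_forall fun x => ?_
    rw [norm_g, norm_toBoundary, Real.rpow_neg_one, mul_inv]

/-- In polar coordinates the Jacobian r cancels the 1/r of the kernel, so only a phase linear in r
survives. The plane is identified with ℂ so that modulus and argument of ξ supply a and the shift of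
the angle. -/
theorem fourier_truncatedKernel (k R : ℝ) (hR : 0 < R) (ξ : Plane) :
    𝓕 (truncatedKernel k R) ξ = ((4 * Real.pi)⁻¹ : ℝ) *
      ∫ θ in Set.Ioo (-Real.pi) Real.pi, ∫ r in (0 : ℝ)..R,
        Complex.exp (Complex.I * (r * (k - 2 * Real.pi * ‖Complex.orthonormalBasisOneI.repr.symm ξ‖
          * Real.cos (θ - (Complex.orthonormalBasisOneI.repr.symm ξ).arg)) : ℝ)) := by
  set w := Complex.orthonormalBasisOneI.repr.symm ξ with hw
  have hpi := Real.pi_pos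
  set Φ : ℝ × ℝ → ℂ := fun p => Complex.exp (Complex.I *
    (p.1 * (k - 2 * Real.pi * ‖w‖ * Real.cos (p.2 - w.arg)) : ℝ)) with hΦ
  have hΦc : Continuous Φ := by fun_prop
  rw [Real.fourier_eq' , ← Complex.orthonormalBasisOneI.measurePreserving_repr.integral_comp
    Complex.orthonormalBasisOneI.repr.toHomeomorph.measurableEmbedding,
    ← Complex.integral_comp_polarCoord_symm]
  have key : ∀ p ∈ polarCoord.target,
      p.1 • (Complex.exp (↑(-2 * Real.pi * inner ℝ (Complex.orthonormalBasisOneI.repr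
          (Complex.polarCoord.symm p)) ξ) * Complex.I) •
        truncatedKernel k R (Complex.orthonormalBasisOneI.repr (Complex.polarCoord.symm p)))
      = (Set.Ioo 0 R ×ˢ Set.Ioo (-Real.pi) Real.pi).indicator
          (fun p => ((4 * Real.pi)⁻¹ : ℝ) * Φ p) p := by
    rintro ⟨r, θ⟩ hp
    rw [polarCoord_target] at hp
    have hr : 0 < r := hp.1
    have hθ := hp.2
    have hnorm : ‖Complex.orthonormalBasisOneI.repr (Complex.polarCoord.symm (r, θ))‖ = r := by
      rw [LinearIsometryEquiv.norm_map, Complex.norm_polarCoord_symm, abs_of_pos hr]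
    have hinner : inner ℝ (Complex.orthonormalBasisOneI.repr (Complex.polarCoord.symm (r, θ))) ξ
        = r * (‖w‖ * Real.cos (θ - w.arg)) := by
      have : ξ = Complex.orthonormalBasisOneI.repr w := by
        rw [hw, LinearIsometryEquiv.apply_symm_apply]
      rw [this, LinearIsometryEquiv.inner_map_map, Real.cos_sub]
      have h1 := Complex.norm_mul_cos_arg w
      have h2 := Complex.norm_mul_sin_arg w
      simp only [Complex.polarCoord_symm_apply, Complex.inner, Complex.mul_re, Complex.mul_im,
        Complex.conj_re, Complex.conj_im, Complex.add_re, Complex.add_im, Complex.ofReal_re,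
        Complex.ofReal_im, Complex.I_re, Complex.I_im]
      linear_combination (-r * Real.cos θ) * h1 - r * Real.sin θ * h2
    rw [hinner]
    by_cases hrR : r < R
    · rw [Set.indicator_of_mem (show (r, θ) ∈ Set.Ioo 0 R ×ˢ Set.Ioo (-Real.pi) Real.pi from
          ⟨⟨hr, hrR⟩, hθ⟩), truncatedKernel,
        Set.indicator_of_mem (by rw [mem_ball_zero_iff, hnorm]; exact hrR), g, norm_toBoundary,
        hnorm]
      simp only [smul_eq_mul, Complex.real_smul, hΦ]
      have e : Complex.exp (Complex.I * (r * (k - 2 * Real.pi * ‖w‖ * Real.cos (θ - w.arg)) : ℝ))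
          = Complex.exp (↑(-2 * Real.pi * (r * (‖w‖ * Real.cos (θ - w.arg)))) * Complex.I)
            * Complex.exp (Complex.I * (k * r : ℝ)) := by
        rw [← Complex.exp_add]
        congr 1
        push_cast
        ring
      rw [e]
      have hrc : (r : ℂ) ≠ 0 := by exact_mod_cast hr.ne'
      have hpc : (Real.pi : ℂ) ≠ 0 := by exact_mod_cast hpi.ne'
      push_cast
      field_simp
    · rw [Set.indicator_of_notMem (fun h => hrR h.1.2), truncatedKernel,
        Set.indicator_of_notMem (by rw [mem_ball_zero_iff, hnorm]; exact hrR)]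
      simp
  rw [setIntegral_congr_fun polarCoord.open_target.measurableSet key,
    setIntegral_indicator (measurableSet_Ioo.prod measurableSet_Ioo),
    Set.inter_eq_right.2 (by
      rw [polarCoord_target]
      exact Set.prod_mono Set.Ioo_subset_Ioi_self le_rfl), integral_const_mul]
  congr 1
  have hint : IntegrableOn Φ (Set.Ioo 0 R ×ˢ Set.Ioo (-Real.pi) Real.pi) :=
    (hΦc.continuousOn.integrableOn_compact (isCompact_Icc.prod isCompact_Icc)).mono_set
      (Set.prod_mono Set.Ioo_subset_Icc_self Set.Ioo_subset_Icc_self)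
  rw [Measure.volume_eq_prod, ← setIntegral_prod_swap, setIntegral_prod]
  · refine setIntegral_congr_fun measurableSet_Ioo fun θ _ => ?_
    rw [intervalIntegral.integral_of_le hR.le, integral_Ioc_eq_integral_Ioo]
    rfl
  · exact hint.swap

theorem norm_fourier_truncatedKernel_le {k R : ℝ} (hk : 0 < k) (hR : 0 < R) (ξ : Plane) :
    ‖𝓕 (truncatedKernel k R) ξ‖ ≤ 2 * Real.pi * Real.sqrt (R / k) := by
  have hpi := Real.pi_pos
  rw [fourier_truncatedKernel k R hR, norm_mul, Complex.norm_real, Real.norm_of_nonneg (by positivity)]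
  have h1 := integral_norm_integral_exp_le hk hR
    (a := 2 * Real.pi * ‖Complex.orthonormalBasisOneI.repr.symm ξ‖) (by positivity)
    (Complex.orthonormalBasisOneI.repr.symm ξ).arg
  calc _ ≤ (4 * Real.pi)⁻¹ * (8 * Real.pi ^ 2 * Real.sqrt (R / k)) := by
        gcongr
        exact (norm_integral_le_integral_norm _).trans h1
    _ = _ := by
        field_simp
        ring

end TruncatedKernel

/-! ### The boundary single layer on L²(D). -/

section SingleLayer

open scoped FourierTransform Convolution ENNReal

variable {D : Set Plane}

/-- For z and w both in D the distance stays below R, so the cut-off is invisible; the cut-off makes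
the kernel integrable on the whole plane. -/
theorem singleLayerBoundary_eq_convolution (hD : MeasurableSet D) {R : ℝ}
    (hDR : ∀ z ∈ D, ∀ w ∈ D, ‖z - w‖ < R) (k : ℝ) (φ : Plane → ℂ) {z : Plane} (hz : z ∈ D) :
    singleLayerBoundary D k φ z =
      (truncatedKernel k R ⋆[ContinuousLinearMap.mul ℂ ℂ] D.indicator φ) z := by
  rw [convolution_mul_swap, singleLayerBoundary, singleLayer, ← integral_indicator hD]
  congr 1 with w
  by_cases hw : w ∈ D
  · rw [Set.indicator_of_mem hw, Set.indicator_of_mem hw, truncatedKernel,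
      Set.indicator_of_mem (by rw [mem_ball_zero_iff]; exact hDR z hz w hw)]
    congr 2
    ext i
    fin_cases i <;> simp [toBoundary]
  · rw [Set.indicator_of_notMem hw, Set.indicator_of_notMem hw, mul_zero]

theorem singleLayerBoundary_congr {φ ψ : Plane → ℂ} {k : ℝ} (h : φ =ᵐ[volume.restrict D] ψ)
    (z : Plane) : singleLayerBoundary D k φ z = singleLayerBoundary D k ψ z := by
  refine integral_congr_ae ?_
  filter_upwards [h] with w hw
  rw [hw]

/-- The boundary operator `S_k^B` is bounded on `L²(D)` with norm `O(k^{-1/2})`. -/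
theorem eLpNorm_singleLayerBoundary_le (hD : MeasurableSet D) {R : ℝ} (hR : 0 < R)
    (hDfin : volume D ≠ ⊤) (hDR : ∀ z ∈ D, ∀ w ∈ D, ‖z - w‖ < R) {k : ℝ} (hk : 0 < k)
    {φ : Plane → ℂ} (hφ : MemLp φ 2 (volume.restrict D)) :
    MemLp (singleLayerBoundary D k φ) 2 (volume.restrict D) ∧
    eLpNorm (singleLayerBoundary D k φ) 2 (volume.restrict D) ≤
      ENNReal.ofReal (2 * Real.pi * Real.sqrt (R / k)) * eLpNorm φ 2 (volume.restrict D) := by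
  have : IsFiniteMeasure (volume.restrict D) := ⟨by simpa using hDfin.lt_top⟩
  have hi : Integrable (D.indicator φ) :=
    (integrable_indicator_iff hD).2 (hφ.integrable (by norm_num))
  have h2 : MemLp (D.indicator φ) 2 := (memLp_indicator_iff_restrict hD).2 hφ
  obtain ⟨m, b⟩ := eLpNorm_convolution_le_of_norm_fourier_le (integrable_truncatedKernel k R) hi h2
    (norm_fourier_truncatedKernel_le hk hR)
  have hae : singleLayerBoundary D k φ =ᵐ[volume.restrict D]
      truncatedKernel k R ⋆[ContinuousLinearMap.mul ℂ ℂ] D.indicator φ := by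
    filter_upwards [ae_restrict_mem hD] with z hz
    exact singleLayerBoundary_eq_convolution hD hDR k φ hz
  refine ⟨(memLp_congr_ae hae).2 (m.restrict D), ?_⟩
  rw [eLpNorm_congr_ae hae, ← eLpNorm_indicator_eq_eLpNorm_restrict hD (f := φ)]
  exact (eLpNorm_mono_measure _ Measure.restrict_le_self).trans b

end SingleLayer

/-! ### Cauchy–Schwarz and multiplication operators on L². -/

section LpTools

open scoped FourierTransform Convolution ENNReal

variable {α : Type*} [MeasurableSpace α] {μ : Measure α}

theorem MeasureTheory.MemLp.norm_toLp_two_sq {f : α → ℂ} (hf : MemLp f 2 μ) :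
    ‖hf.toLp f‖ ^ 2 = ∫ x, ‖f x‖ ^ 2 ∂μ := by
  have h : ((‖hf.toLp f‖ ^ 2 : ℝ) : ℂ) = ((∫ x, ‖f x‖ ^ 2 ∂μ : ℝ) : ℂ) := by
    have := inner_self_eq_norm_sq_to_K (𝕜 := ℂ) (hf.toLp f)
    rw [L2.inner_def] at this
    rw [← integral_complex_ofReal]
    refine Eq.trans ?_ (this.symm.trans ?_)
    · push_cast
      rfl
    · refine integral_congr_ae ?_
      filter_upwards [hf.coeFn_toLp] with x hx
      rw [hx, inner_self_eq_norm_sq_to_K]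
      push_cast
      rfl
  exact_mod_cast h

/-- Cauchy–Schwarz, with the L² norms entering as integrals of squares, the form in which the
weighted kernel bounds arrive. -/
theorem norm_integral_le_of_norm_le_mul {F : α → ℂ} {u v : α → ℝ} (hu : MemLp u 2 μ)
    (hv : MemLp v 2 μ) (hF : ∀ᵐ x ∂μ, ‖F x‖ ≤ u x * v x) {A B : ℝ}
    (hA : 0 ≤ A) (hB : 0 ≤ B) (huA : ∫ x, u x ^ 2 ∂μ ≤ A ^ 2) (hvB : ∫ x, v x ^ 2 ∂μ ≤ B ^ 2) :
    ‖∫ x, F x ∂μ‖ ≤ A * B := by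
  have hinner : inner ℝ (hu.toLp u) (hv.toLp v) = ∫ x, u x * v x ∂μ := by
    rw [L2.inner_def]
    refine integral_congr_ae ?_
    filter_upwards [hu.coeFn_toLp, hv.coeFn_toLp] with x h1 h2
    rw [h1, h2]
    simp [mul_comm]
  have hsq : ∀ {w : α → ℝ} (hw : MemLp w 2 μ) {C : ℝ}, 0 ≤ C → ∫ x, w x ^ 2 ∂μ ≤ C ^ 2 →
      ‖hw.toLp w‖ ≤ C := by
    intro w hw C hC h
    refine le_of_sq_le_sq ?_ hC
    rw [← real_inner_self_eq_norm_sq, L2.inner_def]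
    refine le_trans (le_of_eq (integral_congr_ae ?_)) h
    filter_upwards [hw.coeFn_toLp] with x hx
    rw [hx]
    simp [sq]
  calc ‖∫ x, F x ∂μ‖ ≤ ∫ x, u x * v x ∂μ :=
        norm_integral_le_of_norm_le (hu.integrable_mul hv) hF
    _ ≤ ‖hu.toLp u‖ * ‖hv.toLp v‖ := by
        rw [← hinner]
        exact real_inner_le_norm _ _
    _ ≤ A * B := mul_le_mul (hsq hu hA huA) (hsq hv hB hvB) (norm_nonneg _) hA

theorem exists_mul_clm {m : α → ℂ} (hm : AEStronglyMeasurable m μ) {B : ℝ} (hB : 0 ≤ B)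
    (hmB : ∀ᵐ x ∂μ, ‖m x‖ ≤ B) :
    ∃ M : Lp ℂ 2 μ →L[ℂ] Lp ℂ 2 μ, (∀ φ, M φ =ᵐ[μ] fun x => m x * φ x) ∧ ‖M‖ ≤ B := by
  have hmem : ∀ φ : Lp ℂ 2 μ, MemLp (fun x => m x * φ x) 2 μ := fun φ =>
    (Lp.memLp φ).of_le_mul (hm.mul (Lp.aestronglyMeasurable φ)) (c := B) (by
      filter_upwards [hmB] with x hx
      rw [norm_mul]
      gcongr)
  let M₀ : Lp ℂ 2 μ →ₗ[ℂ] Lp ℂ 2 μ :=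
    { toFun := fun φ => (hmem φ).toLp _
      map_add' := fun φ ψ => by
        apply Lp.ext
        filter_upwards [(hmem φ).coeFn_toLp, (hmem ψ).coeFn_toLp, (hmem (φ + ψ)).coeFn_toLp,
          Lp.coeFn_add φ ψ, Lp.coeFn_add ((hmem φ).toLp _) ((hmem ψ).toLp _)] with x h1 h2 h3 h4 h5
        rw [h5, h3, Pi.add_apply, h1, h2, h4, Pi.add_apply, mul_add]
      map_smul' := fun c φ => by
        apply Lp.ext
        filter_upwards [(hmem φ).coeFn_toLp, (hmem (c • φ)).coeFn_toLp,
          Lp.coeFn_smul c φ, Lp.coeFn_smul c ((hmem φ).toLp _)] with x h1 h2 h3 h4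
        rw [RingHom.id_apply, h4, h2, Pi.smul_apply, h1, h3, Pi.smul_apply, smul_eq_mul, smul_eq_mul]
        ring }
  have hb : ∀ φ, ‖M₀ φ‖ ≤ B * ‖φ‖ := fun φ => Lp.norm_le_mul_norm_of_ae_le_mul (by
    filter_upwards [(hmem φ).coeFn_toLp, hmB] with x h1 h2
    change ‖((hmem φ).toLp _ : α → ℂ) x‖ ≤ _
    rw [h1, norm_mul]
    gcongr)
  exact ⟨M₀.mkContinuous B hb, fun φ => (hmem φ).coeFn_toLp, LinearMap.mkContinuous_norm_le _ hB _⟩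

end LpTools

/-! ### The boundary single layer as a bounded operator. -/

section SingleLayerOperator

open scoped FourierTransform Convolution ENNReal

variable {D : Set Plane}

/-- The boundary operator `S_k^B` as a continuous operator on `L²(D)`. -/
theorem exists_singleLayerBoundary_clm (hD : MeasurableSet D) {R : ℝ} (hR : 0 < R)
    (hDfin : volume D ≠ ⊤) (hDR : ∀ z ∈ D, ∀ w ∈ D, ‖z - w‖ < R) {k : ℝ} (hk : 0 < k) :
    ∃ S : Lp ℂ 2 (volume.restrict D) →L[ℂ] Lp ℂ 2 (volume.restrict D),
      (∀ φ : Lp ℂ 2 (volume.restrict D), S φ =ᵐ[volume.restrict D] singleLayerBoundary D k φ) ∧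
      ‖S‖ ≤ 2 * Real.pi * Real.sqrt (R / k) := by
  have hfin : IsFiniteMeasure (volume.restrict D) := ⟨by simpa using hDfin.lt_top⟩
  have hmem := fun φ : Lp ℂ 2 (volume.restrict D) =>
    eLpNorm_singleLayerBoundary_le hD hR hDfin hDR hk (Lp.memLp φ)
  -- Additivity of the operator needs genuine integrability against the singular kernel, because a
  -- divergent integral has value zero. It holds for almost every z, as for any convolution of
  -- integrable functions.
  have hi : ∀ φ : Lp ℂ 2 (volume.restrict D), ∀ᵐ z ∂(volume.restrict D),
      Integrable (fun w => g k (toBoundary z - toBoundary w) * φ w) (volume.restrict D) := by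
    intro φ
    have h1 : Integrable (D.indicator φ) :=
      (integrable_indicator_iff hD).2 ((Lp.memLp φ).integrable (by norm_num))
    have h2 := h1.ae_convolution_exists (ContinuousLinearMap.mul ℂ ℂ) (integrable_truncatedKernel k R)
    filter_upwards [ae_restrict_of_ae (s := D) h2, ae_restrict_mem hD] with z hz hzD
    have h3 := hz.integrable.restrict (s := D)
    refine h3.congr ?_
    filter_upwards [ae_restrict_mem hD] with w hw
    rw [ContinuousLinearMap.mul_apply', Set.indicator_of_mem hw, truncatedKernel,
      Set.indicator_of_mem (by rw [mem_ball_zero_iff]; exact hDR z hzD w hw), mul_comm]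
    congr 2
    ext i
    fin_cases i <;> simp [toBoundary]
  let S₀ : Lp ℂ 2 (volume.restrict D) →ₗ[ℂ] Lp ℂ 2 (volume.restrict D) :=
    { toFun := fun φ => (hmem φ).1.toLp _
      map_add' := fun φ ψ => by
        apply Lp.ext
        filter_upwards [(hmem φ).1.coeFn_toLp, (hmem ψ).1.coeFn_toLp, (hmem (φ + ψ)).1.coeFn_toLp,
          Lp.coeFn_add ((hmem φ).1.toLp _) ((hmem ψ).1.toLp _), hi φ, hi ψ] with z h1 h2 h3 h4 h5 h6
        rw [h4, h3, Pi.add_apply, h1, h2, singleLayerBoundary_congr (Lp.coeFn_add φ ψ)]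
        simp only [singleLayerBoundary, singleLayer]
        rw [← integral_add h5 h6]
        simp only [Pi.add_apply, mul_add]
      map_smul' := fun c φ => by
        apply Lp.ext
        filter_upwards [(hmem φ).1.coeFn_toLp, (hmem (c • φ)).1.coeFn_toLp,
          Lp.coeFn_smul c ((hmem φ).1.toLp _)] with z h1 h2 h3
        rw [RingHom.id_apply, h3, h2, Pi.smul_apply, h1, singleLayerBoundary_congr (Lp.coeFn_smul c φ)]
        simp only [singleLayerBoundary, singleLayer, Pi.smul_apply, smul_eq_mul]
        rw [← integral_const_mul]
        congr 1 with w
        ring }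
  have hb : ∀ φ, ‖S₀ φ‖ ≤ 2 * Real.pi * Real.sqrt (R / k) * ‖φ‖ := fun φ => by
    change ‖(hmem φ).1.toLp _‖ ≤ _
    rw [Lp.norm_toLp, Lp.norm_def, ← ENNReal.toReal_ofReal
      (show 0 ≤ 2 * Real.pi * Real.sqrt (R / k) by positivity), ← ENNReal.toReal_mul]
    refine ENNReal.toReal_mono (ENNReal.mul_ne_top ENNReal.ofReal_ne_top (Lp.eLpNorm_ne_top φ)) ?_
    exact (hmem φ).2
  exact ⟨S₀.mkContinuous _ hb, fun φ => (hmem φ).1.coeFn_toLp,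
    LinearMap.mkContinuous_norm_le _ (by positivity) _⟩

end SingleLayerOperator

/-! ### The Neumann series. -/

section NeumannSeries

open scoped FourierTransform Convolution ENNReal

variable {V : Type*} [NormedAddCommGroup V] [NormedSpace ℂ V] [CompleteSpace V]

theorem exists_unique_sub_eq_of_norm_lt_one {T : V →L[ℂ] V} (hT : ‖T‖ < 1) (f : V) :
    ∃ φ : V, φ - T φ = f ∧ (∀ ψ, ψ - T ψ = f → ψ = φ) ∧ HasSum (fun n : ℕ => (T ^ n) f) φ := by
  refine ⟨(∑' n : ℕ, T ^ n) f, ?_, ?_, ?_⟩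
  · have := congrArg (fun A : V →L[ℂ] V => A f) (mul_neg_geom_series T hT)
    simpa using this
  · intro ψ hψ
    have := congrArg (fun A : V →L[ℂ] V => A ψ) (geom_series_mul_neg T hT)
    rw [← hψ]
    exact this.symm
  · exact (summable_geometric_of_norm_lt_one hT).hasSum.mapL (ContinuousLinearMap.apply ℂ V f)

end NeumannSeries

/-! ### Bounds for the terms of the Born series. -/

section BornSeries

open scoped FourierTransform Convolution ENNReal

variable {D : Set Plane} {U : Set Space}

theorem norm_proj_sub_le (x : Space) (z : Plane) : ‖z - proj x‖ ≤ ‖x - toBoundary z‖ := by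
  rw [EuclideanSpace.norm_eq, EuclideanSpace.norm_eq]
  refine Real.sqrt_le_sqrt ?_
  simp only [Fin.sum_univ_succ, Fin.sum_univ_zero, toBoundary, proj, Real.norm_eq_abs, sq_abs,
    PiLp.sub_apply]
  simp
  nlinarith [sq_nonneg (x 2)]

theorem apply_two_le_norm_sub_toBoundary (x : Space) (z : Plane) : x 2 ≤ ‖x - toBoundary z‖ := by
  have h := EuclideanSpace.norm_eq (x - toBoundary z)
  have h2 : ‖(x - toBoundary z) 2‖ ≤ ‖x - toBoundary z‖ := PiLp.norm_apply_le _ _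
  have h3 : (x - toBoundary z) 2 = x 2 := by simp [toBoundary]
  rw [h3] at h2
  exact (le_abs_self _).trans h2

/-- A boundary point is its own mirror image, so the incident field doubles; together with the 2 in
φ₁ this is the source of the factor 4 in the bounds. -/
theorem uIn_toBoundary (k : ℝ) (z : Plane) (y : Space) :
    uIn k (toBoundary z) y = 2 * g k (y - toBoundary z) := by
  have h1 : reflect (toBoundary z) = toBoundary z := by simp [reflect, toBoundary]
  have h2 : g k (toBoundary z - y) = g k (y - toBoundary z) := by
    simp only [g, norm_sub_rev]
  rw [uIn, h1, h2, two_mul]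

theorem measurable_g_sub_toBoundary (k : ℝ) (x : Space) :
    Measurable fun z : Plane => g k (x - toBoundary z) :=
  (measurable_g k).comp (measurable_const.sub continuous_toBoundary.measurable)

theorem memLp_g_sub_toBoundary (hDfin : volume D ≠ ⊤) {x : Space} (hx : 0 < x 2) (k : ℝ) :
    MemLp (fun z : Plane => g k (x - toBoundary z)) 2 (volume.restrict D) := by
  have hfin : IsFiniteMeasure (volume.restrict D) := ⟨by simpa using hDfin.lt_top⟩
  refine MemLp.of_bound (measurable_g_sub_toBoundary k x).aestronglyMeasurable
    (4 * Real.pi * x 2)⁻¹ (Filter.Eventually.of_forall fun z => ?_)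
  rw [norm_g]
  have := apply_two_le_norm_sub_toBoundary x z
  have := Real.pi_pos
  gcongr

/-- Weighted square integrability of the fundamental solution, uniformly up to the boundary:
the weight vanishes at `proj x` at a Hölder rate. -/
theorem integral_weight_mul_norm_g_sq_le (hD : MeasurableSet D) {R γ : ℝ} (hγ : 0 < γ)
    (hDU : ∀ z ∈ D, ∀ x ∈ U, ‖z - proj x‖ < R) (hUD : Disjoint (proj '' U) D)
    {ℓ : Plane → ℝ} (hℓ : Continuous ℓ) {H : ℝ} (hH : 0 ≤ H)
    (hh : ∀ z ∈ D, ∀ x ∈ U, |ℓ z| ≤ H * ‖z - proj x‖ ^ γ) (k : ℝ) {x : Space} (hx : x ∈ U) :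
    MemLp (fun z => Real.sqrt |ℓ z| * ‖g k (x - toBoundary z)‖) 2 (volume.restrict D) ∧
    ∫ z in D, (Real.sqrt |ℓ z| * ‖g k (x - toBoundary z)‖) ^ 2 ≤
      ((4 * Real.pi)⁻¹ ^ 2 * ∫ w in Metric.ball (0 : Plane) R, ‖w‖ ^ (γ - 2)) * H := by
  have hpi := Real.pi_pos
  have hint : IntegrableOn (fun w : Plane => ‖w‖ ^ (γ - 2)) (Metric.ball 0 R) :=
    integrableOn_norm_rpow_ball (by linarith) R
  set B : Plane → ℝ := (Metric.ball (0 : Plane) R).indicator fun w => ‖w‖ ^ (γ - 2) with hB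
  have hBi : Integrable B := (integrable_indicator_iff measurableSet_ball).2 hint
  have hB0 : ∀ w, 0 ≤ B w := fun w => Set.indicator_nonneg (fun w _ => by positivity) w
  -- Distances only shrink under projection, so |g_k|² is at most (4π)⁻² |z - x'|⁻², and the Hölder
  -- factor restores integrability. The projection x' is not in D, hence z ≠ x' and the negative
  -- powers are honest.
  have hbound : ∀ z ∈ D, (Real.sqrt |ℓ z| * ‖g k (x - toBoundary z)‖) ^ 2 ≤
      (4 * Real.pi)⁻¹ ^ 2 * H * B (z - proj x) := by
    intro z hz
    have hne : z - proj x ≠ 0 := by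
      rw [sub_ne_zero]
      rintro rfl
      exact Set.disjoint_left.1 hUD (Set.mem_image_of_mem _ hx) hz
    have hpos : 0 < ‖z - proj x‖ := norm_pos_iff.2 hne
    rw [mul_pow, Real.sq_sqrt (abs_nonneg _), norm_g, hB,
      Set.indicator_of_mem (by rw [mem_ball_zero_iff]; exact hDU z hz x hx),
      Real.rpow_sub hpos, mul_inv, mul_pow]
    have h1 := hh z hz x hx
    have h2 : (‖x - toBoundary z‖⁻¹) ^ 2 ≤ (‖z - proj x‖⁻¹) ^ 2 := by
      have := norm_proj_sub_le x z
      gcongr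
    calc |ℓ z| * ((4 * Real.pi)⁻¹ ^ 2 * (‖x - toBoundary z‖⁻¹) ^ 2)
        ≤ (H * ‖z - proj x‖ ^ γ) * ((4 * Real.pi)⁻¹ ^ 2 * (‖z - proj x‖⁻¹) ^ 2) := by gcongr
      _ = _ := by
        rw [Real.rpow_two]
        field_simp
  have hmeas : Measurable fun z => Real.sqrt |ℓ z| * ‖g k (x - toBoundary z)‖ :=
    (hℓ.abs.sqrt.measurable).mul (measurable_g_sub_toBoundary k x).norm
  have hBx : Integrable (fun z => (4 * Real.pi)⁻¹ ^ 2 * H * B (z - proj x)) :=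
    (hBi.comp_sub_right (proj x)).const_mul _
  have hi : IntegrableOn (fun z => (Real.sqrt |ℓ z| * ‖g k (x - toBoundary z)‖) ^ 2) D := by
    refine hBx.integrableOn.mono' (hmeas.pow_const 2).aestronglyMeasurable ?_
    filter_upwards [ae_restrict_mem hD] with z hz
    rw [Real.norm_of_nonneg (sq_nonneg _)]
    exact hbound z hz
  refine ⟨(memLp_two_iff_integrable_sq hmeas.aestronglyMeasurable).2 hi, ?_⟩
  calc ∫ z in D, (Real.sqrt |ℓ z| * ‖g k (x - toBoundary z)‖) ^ 2
      ≤ ∫ z in D, (4 * Real.pi)⁻¹ ^ 2 * H * B (z - proj x) :=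
        setIntegral_mono_on hi hBx.integrableOn hD hbound
    _ ≤ ∫ z, (4 * Real.pi)⁻¹ ^ 2 * H * B (z - proj x) :=
        setIntegral_le_integral hBx (Filter.Eventually.of_forall fun z => by
          have := hB0 (z - proj x)
          positivity)
    _ = _ := by
        rw [integral_const_mul, integral_sub_right_eq_self B (proj x), hB,
          integral_indicator measurableSet_ball]
        ring

theorem norm_impedance (ℓ : Plane → ℝ) {k : ℝ} (hk : 0 < k) (p : ℝ) (z : Plane) :
    ‖impedance ℓ p k z‖ = k ^ (-p) * |ℓ z| := by
  rw [impedance, Complex.norm_real, Real.norm_eq_abs, abs_div, abs_of_pos (Real.rpow_pos_of_pos hk p),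
    Real.rpow_neg hk.le]
  ring

theorem continuous_impedance {ℓ : Plane → ℝ} (hℓ : Continuous ℓ) (p k : ℝ) :
    Continuous (impedance ℓ p k) :=
  Complex.continuous_ofReal.comp (hℓ.div_const _)

set_option maxHeartbeats 1000000 in
/-- Mapping properties of the Born iteration in `L²(D)` for a fixed wave number. -/
theorem exists_born_operator (hD : MeasurableSet D) {R : ℝ} (hR : 0 < R)
    (hDfin : volume D ≠ ⊤) (hDR : ∀ z ∈ D, ∀ w ∈ D, ‖z - w‖ < R)
    {ℓ : Plane → ℝ} (hℓ : Continuous ℓ) {H : ℝ} (hH : 0 ≤ H) (hb : ∀ z ∈ D, |ℓ z| ≤ H)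
    {A : ℝ} (hA : 0 ≤ A) {k : ℝ} (hk : 0 < k)
    (hmem : ∀ x ∈ U, MemLp (fun z => Real.sqrt |ℓ z| * ‖g k (x - toBoundary z)‖) 2
      (volume.restrict D))
    (hint : ∀ x ∈ U, ∫ z in D, (Real.sqrt |ℓ z| * ‖g k (x - toBoundary z)‖) ^ 2 ≤ A ^ 2) (p : ℝ) :
    ∃ T : Lp ℂ 2 (volume.restrict D) →L[ℂ] Lp ℂ 2 (volume.restrict D),
      ‖T‖ ≤ 2 * k ^ (-p) * H * (2 * Real.pi * Real.sqrt (R / k)) ∧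
      (∀ φ : Lp ℂ 2 (volume.restrict D), T φ =ᵐ[volume.restrict D]
        fun z => 2 * impedance ℓ p k z * singleLayerBoundary D k φ z) ∧
      ∀ y ∈ U, ∃ f : Lp ℂ 2 (volume.restrict D),
        f =ᵐ[volume.restrict D] bornDensity D ℓ p k y 0 ∧
        ∀ x ∈ U, ∀ n : ℕ, ‖singleLayer D k ((T ^ n) f) x‖ ≤
          4 * k ^ (-p) * A ^ 2 * (2 * k ^ (-p) * H * (2 * Real.pi * Real.sqrt (R / k))) ^ n := by
  obtain ⟨S, hS, hSn⟩ := exists_singleLayerBoundary_clm hD hR hDfin hDR hk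
  have hkp : 0 < k ^ (-p) := Real.rpow_pos_of_pos hk _
  obtain ⟨M, hM, hMn⟩ := exists_mul_clm (μ := volume.restrict D)
    (m := fun z => 2 * impedance ℓ p k z) (B := 2 * k ^ (-p) * H)
    ((continuous_impedance hℓ p k).const_smul (2 : ℂ)).aestronglyMeasurable (by positivity) (by
      filter_upwards [ae_restrict_mem hD] with z hz
      rw [norm_mul, norm_impedance ℓ hk, mul_assoc 2]
      have := hb z hz
      simp only [Complex.norm_ofNat]
      gcongr)
  set s := 2 * Real.pi * Real.sqrt (R / k) with hs
  have hs0 : 0 ≤ s := by have := Real.pi_pos; positivity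
  set q := 2 * k ^ (-p) * H * s with hq
  have hq0 : 0 ≤ q := by positivity
  have hTn : ‖M ∘L S‖ ≤ q := (ContinuousLinearMap.opNorm_comp_le M S).trans
    (mul_le_mul hMn hSn (norm_nonneg _) (by positivity))
  have hT : ∀ φ : Lp ℂ 2 (volume.restrict D), (M ∘L S) φ =ᵐ[volume.restrict D]
      fun z => 2 * impedance ℓ p k z * singleLayerBoundary D k φ z := by
    intro φ
    filter_upwards [hM (S φ), hS φ] with z h1 h2
    rw [ContinuousLinearMap.comp_apply, h1, h2]
  refine ⟨M ∘L S, hTn, hT, fun y hy => ?_⟩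
  have hsqrt : ∀ z, Real.sqrt |ℓ z| * Real.sqrt |ℓ z| = |ℓ z| := fun z =>
    Real.mul_self_sqrt (abs_nonneg _)
  have hsqrtH : ∀ z ∈ D, Real.sqrt |ℓ z| ≤ Real.sqrt H := fun z hz => Real.sqrt_le_sqrt (hb z hz)
  -- One square root of |ℓ| tames the kernel at y; the other stays available for the kernel at x, or
  -- is bounded by √H.
  have hnorm0 : ∀ z, ‖bornDensity D ℓ p k y 0 z‖ =
      4 * k ^ (-p) * (Real.sqrt |ℓ z| * (Real.sqrt |ℓ z| * ‖g k (y - toBoundary z)‖)) := by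
    intro z
    rw [← mul_assoc (Real.sqrt _), hsqrt]
    simp only [bornDensity, uIn_toBoundary, norm_mul, norm_impedance ℓ hk, Complex.norm_ofNat]
    ring
  have hf0 : MemLp (bornDensity D ℓ p k y 0) 2 (volume.restrict D) := by
    refine (hmem y hy).of_le_mul (c := 4 * k ^ (-p) * Real.sqrt H) ?_ ?_
    · have : bornDensity D ℓ p k y 0 =
          fun z => 2 * impedance ℓ p k z * (2 * g k (y - toBoundary z)) := by
        ext z
        simp only [bornDensity, uIn_toBoundary]
      rw [this]
      exact (((continuous_impedance hℓ p k).measurable.const_mul 2).mul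
        ((measurable_g_sub_toBoundary k y).const_mul 2)).aestronglyMeasurable
    · filter_upwards [ae_restrict_mem hD] with z hz
      rw [hnorm0, Real.norm_of_nonneg (by positivity), mul_assoc (4 * k ^ (-p))]
      have := hsqrtH z hz
      gcongr
  have hfn : ‖hf0.toLp _‖ ≤ 4 * k ^ (-p) * Real.sqrt H * A := by
    refine le_of_sq_le_sq ?_ (by positivity)
    rw [hf0.norm_toLp_two_sq]
    have hi2 : IntegrableOn (fun z => (Real.sqrt |ℓ z| * ‖g k (y - toBoundary z)‖) ^ 2) D :=
      (memLp_two_iff_integrable_sq (hmem y hy).aestronglyMeasurable).1 (hmem y hy)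
    calc ∫ z in D, ‖bornDensity D ℓ p k y 0 z‖ ^ 2
        ≤ ∫ z in D, (4 * k ^ (-p) * Real.sqrt H) ^ 2 *
            (Real.sqrt |ℓ z| * ‖g k (y - toBoundary z)‖) ^ 2 := by
          refine setIntegral_mono_on
            ((memLp_two_iff_integrable_sq_norm hf0.aestronglyMeasurable).1 hf0)
            (hi2.const_mul _) hD fun z hz => ?_
          rw [hnorm0, ← mul_pow, mul_assoc (4 * k ^ (-p))]
          have := hsqrtH z hz
          gcongr
      _ ≤ (4 * k ^ (-p) * Real.sqrt H) ^ 2 * A ^ 2 := by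
          rw [integral_const_mul]
          exact mul_le_mul_of_nonneg_left (hint y hy) (sq_nonneg _)
      _ = _ := by rw [← mul_pow]
  have hcoe := hf0.coeFn_toLp
  refine ⟨hf0.toLp _, hcoe, fun x hx n => ?_⟩
  cases n with
  | zero =>
    have h1 : singleLayer D k (((M ∘L S) ^ 0) (hf0.toLp _)) x =
        ∫ z in D, g k (x - toBoundary z) * bornDensity D ℓ p k y 0 z := by
      refine integral_congr_ae ?_
      filter_upwards [hcoe] with z hz
      rw [pow_zero, one_apply_eq_self, hz]
    rw [h1]
    have := norm_integral_le_of_norm_le_mul (A := 4 * k ^ (-p) * A) (B := A)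
      (F := fun z => g k (x - toBoundary z) * bornDensity D ℓ p k y 0 z)
      ((hmem x hx).const_mul (4 * k ^ (-p))) (hmem y hy)
      (Filter.Eventually.of_forall fun z => by
        rw [norm_mul, hnorm0]
        exact le_of_eq (by ring)) (by positivity) hA (by
        simp_rw [mul_pow (4 * k ^ (-p))]
        rw [integral_const_mul]
        exact mul_le_mul_of_nonneg_left (hint x hx) (sq_nonneg _)) (hint y hy)
    refine this.trans (le_of_eq ?_)
    ring
  | succ n =>
    -- The last application of T is opened up: half of its weight ℓ goes to the kernel at x, the
    -- other half to S φ. The two factors √H, from here and from the norm of f, supply the H of the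
    -- additional factor q.
    set φ := ((M ∘L S) ^ n) (hf0.toLp _) with hφ
    have hφn : ‖φ‖ ≤ q ^ n * (4 * k ^ (-p) * Real.sqrt H * A) := by
      calc ‖φ‖ ≤ ‖(M ∘L S) ^ n‖ * ‖hf0.toLp _‖ := ContinuousLinearMap.le_opNorm _ _
        _ ≤ q ^ n * (4 * k ^ (-p) * Real.sqrt H * A) := by
          have h2 : ‖(M ∘L S) ^ n‖ ≤ q ^ n := by
            -- Exponent zero is treated apart: if L²(D) is trivial, the identity has norm 0 and only
            -- the inequality holds.
            rcases Nat.eq_zero_or_pos n with rfl | hn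
            · rw [pow_zero, pow_zero]
              exact ContinuousLinearMap.norm_id_le
            · exact (norm_pow_le' _ hn).trans (pow_le_pow_left₀ (norm_nonneg _) hTn n)
          gcongr
    have hSφ : ‖S φ‖ ≤ s * ‖φ‖ := (S.le_opNorm φ).trans (by gcongr)
    have hpow : ((M ∘L S) ^ (n + 1)) (hf0.toLp _) = (M ∘L S) φ := by
      rw [pow_succ', hφ, mul_apply_eq_comp]
    have h1 : singleLayer D k (((M ∘L S) ^ (n + 1)) (hf0.toLp _)) x =
        ∫ z in D, g k (x - toBoundary z) * (2 * impedance ℓ p k z * S φ z) := by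
      rw [hpow]
      refine integral_congr_ae ?_
      filter_upwards [hM (S φ)] with z hz
      rw [ContinuousLinearMap.comp_apply, hz]
    rw [h1]
    have hSm : MemLp (fun z => Real.sqrt |ℓ z| * ‖S φ z‖) 2 (volume.restrict D) :=
      (Lp.memLp (S φ)).of_le_mul (c := Real.sqrt H)
        (hℓ.abs.sqrt.aestronglyMeasurable.mul (Lp.aestronglyMeasurable (S φ)).norm) (by
          filter_upwards [ae_restrict_mem hD] with z hz
          rw [Real.norm_of_nonneg (by positivity)]
          have := hsqrtH z hz
          gcongr)
    have hSint : ∫ z in D, (Real.sqrt |ℓ z| * ‖S φ z‖) ^ 2 ≤ (Real.sqrt H * (s * ‖φ‖)) ^ 2 := by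
      have h3 : ‖S φ‖ ^ 2 = ∫ z in D, ‖S φ z‖ ^ 2 := by
        have := (Lp.memLp (S φ)).norm_toLp_two_sq
        rwa [Lp.toLp_coeFn] at this
      have h4 : IntegrableOn (fun z => ‖S φ z‖ ^ 2) D :=
        (memLp_two_iff_integrable_sq_norm (Lp.aestronglyMeasurable _)).1 (Lp.memLp (S φ))
      calc ∫ z in D, (Real.sqrt |ℓ z| * ‖S φ z‖) ^ 2
          ≤ ∫ z in D, Real.sqrt H ^ 2 * ‖S φ z‖ ^ 2 := by
            refine setIntegral_mono_on
              ((memLp_two_iff_integrable_sq hSm.aestronglyMeasurable).1 hSm)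
              (h4.const_mul _) hD fun z hz => ?_
            rw [← mul_pow]
            have := hsqrtH z hz
            gcongr
        _ = (Real.sqrt H * ‖S φ‖) ^ 2 := by rw [integral_const_mul, ← h3, mul_pow]
        _ ≤ _ := by gcongr
    have := norm_integral_le_of_norm_le_mul (A := 2 * k ^ (-p) * A) (B := Real.sqrt H * (s * ‖φ‖))
      (F := fun z => g k (x - toBoundary z) * (2 * impedance ℓ p k z * S φ z))
      ((hmem x hx).const_mul (2 * k ^ (-p))) hSm
      (Filter.Eventually.of_forall fun z => by
        rw [norm_mul, norm_mul, norm_mul, norm_impedance ℓ hk, Complex.norm_ofNat]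
        refine le_of_eq ?_
        linear_combination (-(2 * ‖g k (x - toBoundary z)‖ * k ^ (-p) * ‖S φ z‖)) * hsqrt z)
      (by positivity) (by positivity) (by
        simp_rw [mul_pow (2 * k ^ (-p))]
        rw [integral_const_mul]
        exact mul_le_mul_of_nonneg_left (hint x hx) (sq_nonneg _)) hSint
    calc _ ≤ 2 * k ^ (-p) * A * (Real.sqrt H * (s * ‖φ‖)) := this
      _ ≤ 2 * k ^ (-p) * A * (Real.sqrt H * (s * (q ^ n * (4 * k ^ (-p) * Real.sqrt H * A)))) := by
          gcongr
      _ = 4 * k ^ (-p) * A ^ 2 * (2 * k ^ (-p) * (Real.sqrt H * Real.sqrt H) * s) * q ^ n := by ring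
      _ = _ := by
          rw [Real.mul_self_sqrt hH, ← hq, pow_succ']
          ring

end BornSeries

/-! ### Convergence of the Born series for a Hölder impedance. -/

section BornConvergence

open scoped FourierTransform Convolution ENNReal

variable {D : Set Plane} {U : Set Space}

theorem singleLayer_congr {φ ψ : Plane → ℂ} {k : ℝ} (h : φ =ᵐ[volume.restrict D] ψ)
    (x : Space) : singleLayer D k φ x = singleLayer D k ψ x := by
  refine integral_congr_ae ?_
  filter_upwards [h] with w hw
  rw [hw]

/-- At a fixed x off the plane the kernel is bounded on D, so evaluation of the potential is
continuous on L²(D). It carries the Neumann series from L²(D) to values at x. -/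
theorem exists_singleLayer_clm (hDfin : volume D ≠ ⊤) {x : Space} (hx : 0 < x 2) (k : ℝ) :
    ∃ E : Lp ℂ 2 (volume.restrict D) →L[ℂ] ℂ, ∀ φ : Lp ℂ 2 (volume.restrict D),
      E φ = singleLayer D k φ x := by
  have hm := memLp_g_sub_toBoundary hDfin hx k
  have hm' : MemLp (fun z : Plane => (starRingEnd ℂ) (g k (x - toBoundary z))) 2
      (volume.restrict D) := hm.star
  refine ⟨innerSL ℂ (hm'.toLp _), fun φ => ?_⟩
  rw [innerSL_apply_apply, L2.inner_def]
  refine integral_congr_ae ?_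
  filter_upwards [hm'.coeFn_toLp] with z hz
  rw [hz]
  simp [mul_comm]

theorem bornDensity_ae_eq_pow {ℓ : Plane → ℝ} {p k : ℝ} {y : Space}
    {T : Lp ℂ 2 (volume.restrict D) →L[ℂ] Lp ℂ 2 (volume.restrict D)}
    (hT : ∀ φ : Lp ℂ 2 (volume.restrict D), T φ =ᵐ[volume.restrict D]
        fun z => 2 * impedance ℓ p k z * singleLayerBoundary D k φ z)
    {f : Lp ℂ 2 (volume.restrict D)} (hf : f =ᵐ[volume.restrict D] bornDensity D ℓ p k y 0)
    (n : ℕ) : (T ^ n) f =ᵐ[volume.restrict D] bornDensity D ℓ p k y n := by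
  induction n with
  | zero => simpa using hf
  | succ n ih =>
    rw [pow_succ', mul_apply_eq_comp]
    filter_upwards [hT ((T ^ n) f)] with z hz
    rw [hz, bornDensity, singleLayerBoundary_congr ih]

theorem exists_radius (hD_bdd : Bornology.IsBounded D) (hU_bdd : Bornology.IsBounded U) :
    ∃ R : ℝ, 0 < R ∧ (∀ z ∈ D, ‖z‖ < R) ∧ (∀ x ∈ U, ‖proj x‖ < R) := by
  obtain ⟨a, ha⟩ := hD_bdd.exists_norm_le
  obtain ⟨b, hb⟩ := hU_bdd.exists_norm_le
  have hproj : ∀ x : Space, ‖proj x‖ ≤ ‖x‖ := by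
    intro x
    have := norm_proj_sub_le x 0
    have h0 : toBoundary 0 = 0 := by ext i; fin_cases i <;> simp [toBoundary]
    simpa [h0] using this
  refine ⟨max (max a b) 0 + 1, by positivity, fun z hz => ?_, fun x hx => ?_⟩
  · have := ha z hz
    have := le_max_left (max a b) 0
    have := le_max_left a b
    linarith
  · have := (hproj x).trans (hb x hx)
    have := le_max_left (max a b) 0
    have := le_max_right a b
    linarith

/-- The deterministic Born series: bounds and convergence for an impedance profile `ℓ` which is
bounded by `H` on `D` and vanishes at a Hölder rate towards the projection of `U`. -/
theorem born_series_of_holder (hD_open : IsOpen D) (hD_bdd : Bornology.IsBounded D)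
    (hU_bdd : Bornology.IsBounded U) (hU : U ⊆ upperHalfSpace) (hUD : Disjoint (proj '' U) D)
    {γ : ℝ} (hγ : 0 < γ) {p : ℝ} (hp : 1 / 2 < p) :
    ∃ c₁ c₂ : ℝ, 0 ≤ c₁ ∧ 0 ≤ c₂ ∧ ∀ ℓ : Plane → ℝ, Continuous ℓ → ∀ H : ℝ, 0 ≤ H →
      (∀ z ∈ D, |ℓ z| ≤ H) →
      (∀ z ∈ D, ∀ x ∈ U, |ℓ z| ≤ H * ‖z - proj x‖ ^ γ) →
        (∀ k : ℝ, 1 ≤ k → ∀ y ∈ U, ∀ n : ℕ,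
          MemLp (bornDensity D ℓ p k y n) 2 (volume.restrict D)) ∧
        (∀ k : ℝ, 1 ≤ k → ∀ n : ℕ, 1 ≤ n → ∀ x ∈ U, ∀ y ∈ U,
          ‖bornTerm D ℓ p k x y n‖ ≤
            (c₁ * H) * (c₂ * H) ^ (n - 1) * k ^ (-((n : ℝ) - 1) / 2 - n * p)) ∧
        (∀ k : ℝ, max 1 (2 * (c₂ * H)) ≤ k → ∀ y ∈ U,
          ∃ φ : Lp ℂ 2 (volume.restrict D),
            SolvesBoundaryEquation D ℓ p k y φ ∧
            (∀ ψ : Lp ℂ 2 (volume.restrict D), SolvesBoundaryEquation D ℓ p k y ψ → ψ = φ) ∧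
            ∀ x ∈ U,
              HasSum (fun n : ℕ => bornTerm D ℓ p k x y (n + 1)) (singleLayer D k φ x) ∧
              (x ≠ y → HasSum (fun n : ℕ => bornTerm D ℓ p k x y n)
                (uIn k x y + singleLayer D k φ x))) := by
  obtain ⟨r, hr, hrD, hrU⟩ := exists_radius hD_bdd hU_bdd
  have hpi := Real.pi_pos
  have hDm := hD_open.measurableSet
  have hDfin : volume D ≠ ⊤ := hD_bdd.measure_lt_top.ne
  set R := 2 * r with hR
  have hR0 : 0 < R := by positivity
  have hDR : ∀ z ∈ D, ∀ w ∈ D, ‖z - w‖ < R := fun z hz w hw => by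
    have := norm_sub_le z w
    have := hrD z hz
    have := hrD w hw
    linarith
  have hDU : ∀ z ∈ D, ∀ x ∈ U, ‖z - proj x‖ < R := fun z hz x hx => by
    have := norm_sub_le z (proj x)
    have := hrD z hz
    have := hrU x hx
    linarith
  set c := (4 * Real.pi)⁻¹ ^ 2 * ∫ w in Metric.ball (0 : Plane) R, ‖w‖ ^ (γ - 2) with hc
  have hc0 : 0 ≤ c := mul_nonneg (sq_nonneg _)
    (setIntegral_nonneg measurableSet_ball fun w _ => by positivity)
  -- With A² = cH the prefactor 4A² is (4c)H, and 2H · 2π√R, the operator bound without its powers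
  -- of k, is (4π√R)H.
  refine ⟨4 * c, 4 * Real.pi * Real.sqrt R, by positivity, by positivity,
    fun ℓ hℓ H hH hb hh => ?_⟩
  have hcH : Real.sqrt (c * H) ^ 2 = c * H := Real.sq_sqrt (by positivity)
  have hop : ∀ k : ℝ, 1 ≤ k → _ := fun k hk =>
    exists_born_operator (U := U) hDm hR0 hDfin hDR hℓ hH hb (A := Real.sqrt (c * H))
      (Real.sqrt_nonneg _) (k := k) (by linarith)
      (fun x hx => (integral_weight_mul_norm_g_sq_le hDm hγ hDU hUD hℓ hH hh k hx).1)
      (fun x hx => by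
        rw [hcH]
        exact (integral_weight_mul_norm_g_sq_le hDm hγ hDU hUD hℓ hH hh k hx).2) p
  have hq : ∀ k : ℝ, 1 ≤ k → 2 * k ^ (-p) * H * (2 * Real.pi * Real.sqrt (R / k))
      = (4 * Real.pi * Real.sqrt R * H) * k ^ (-(1 / 2) - p) := by
    intro k hk
    have hk0 : 0 < k := by linarith
    rw [Real.sqrt_div hR0.le, Real.sqrt_eq_rpow k, sub_eq_add_neg, Real.rpow_add hk0,
      Real.rpow_neg hk0.le (1 / 2)]
    ring
  refine ⟨fun k hk y hy n => ?_, fun k hk n hn x hx y hy => ?_, fun k hk y hy => ?_⟩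
  · obtain ⟨T, -, hT, hf⟩ := hop k hk
    obtain ⟨f, hf, -⟩ := hf y hy
    exact (memLp_congr_ae (bornDensity_ae_eq_pow hT hf n)).1 (Lp.memLp _)
  · obtain ⟨T, -, hT, hf⟩ := hop k hk
    obtain ⟨f, hf, hest⟩ := hf y hy
    obtain ⟨n, rfl⟩ : ∃ m, n = m + 1 := ⟨n - 1, by omega⟩
    have hk0 : 0 < k := by linarith
    rw [bornTerm, ← singleLayer_congr (bornDensity_ae_eq_pow hT hf n)]
    refine (hest x hx n).trans (le_of_eq ?_)
    rw [hq k hk, hcH, mul_pow _ (k ^ _), ← Real.rpow_natCast (k ^ _), ← Real.rpow_mul hk0.le,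
      Nat.add_sub_cancel]
    have e : k ^ (-(((n + 1 : ℕ) : ℝ) - 1) / 2 - (n + 1 : ℕ) * p)
        = k ^ (-p) * k ^ ((-(1 / 2) - p) * n) := by
      rw [← Real.rpow_add hk0]
      congr 1
      push_cast
      ring
    rw [e]
    ring
  · have hk1 : 1 ≤ k := (le_max_left _ _).trans hk
    have hk2 : 2 * (4 * Real.pi * Real.sqrt R * H) ≤ k := (le_max_right _ _).trans hk
    have hk0 : 0 < k := by linarith
    obtain ⟨T, hTn, hT, hf⟩ := hop k hk1
    obtain ⟨f, hf, -⟩ := hf y hy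
    have hT1 : ‖T‖ < 1 := by
      refine hTn.trans_lt ?_
      rw [hq k hk1]
      -- Here p > 1/2 enters: it makes a threshold linear in H sufficient, leaving ‖T‖ ≤ 1/2.
      have h1 : k ^ (-(1 / 2) - p) ≤ k⁻¹ := by
        rw [← Real.rpow_neg_one]
        exact Real.rpow_le_rpow_of_exponent_le hk1 (by linarith)
      calc (4 * Real.pi * Real.sqrt R * H) * k ^ (-(1 / 2) - p)
          ≤ (k / 2) * k⁻¹ := by
            have h3 : 4 * Real.pi * Real.sqrt R * H ≤ k / 2 := by linarith
            gcongr
        _ < 1 := by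
          rw [div_mul_eq_mul_div, mul_inv_cancel₀ hk0.ne']
          norm_num
    obtain ⟨φ, hφ, huniq, hsum⟩ := exists_unique_sub_eq_of_norm_lt_one hT1 f
    have hsolve : ∀ ψ : Lp ℂ 2 (volume.restrict D),
        SolvesBoundaryEquation D ℓ p k y ψ ↔ ψ - T ψ = f := by
      intro ψ
      have hpt : ∀ z, (1 / 2 : ℂ) * ψ z - impedance ℓ p k z * singleLayerBoundary D k ψ z
          = impedance ℓ p k z * uIn k (toBoundary z) y ↔
          ψ z - 2 * impedance ℓ p k z * singleLayerBoundary D k ψ z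
            = bornDensity D ℓ p k y 0 z := by
        intro z
        rw [bornDensity]
        constructor
        · intro h
          linear_combination 2 * h
        · intro h
          linear_combination (1 / 2 : ℂ) * h
      constructor
      · intro h
        apply Lp.ext
        filter_upwards [h, hT ψ, hf, Lp.coeFn_sub ψ (T ψ)] with z h1 h2 h3 h4
        rw [h4, Pi.sub_apply, h2, h3]
        exact (hpt z).1 h1
      · intro h
        have h' : ψ =ᵐ[volume.restrict D] ψ := Filter.EventuallyEq.rfl
        filter_upwards [hT ψ, hf, Lp.coeFn_sub ψ (T ψ)] with z h2 h3 h4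
        rw [hpt z, ← h2, ← h3, ← h, h4, Pi.sub_apply]
    refine ⟨φ, (hsolve φ).2 hφ, fun ψ hψ => huniq ψ ((hsolve ψ).1 hψ), fun x hx => ?_⟩
    obtain ⟨E, hE⟩ := exists_singleLayer_clm hDfin (show 0 < x 2 from hU hx) k
    have hs : HasSum (fun n : ℕ => bornTerm D ℓ p k x y (n + 1)) (singleLayer D k φ x) := by
      have := hsum.mapL E
      rw [hE] at this
      refine this.congr_fun ?_
      intro n
      rw [hE, bornTerm, singleLayer_congr (bornDensity_ae_eq_pow hT hf n)]
    refine ⟨hs, fun _ => ?_⟩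
    have := (hasSum_nat_add_iff (f := fun n => bornTerm D ℓ p k x y n) 1).1 hs
    rw [Finset.sum_range_one, add_comm] at this
    exact this

end BornConvergence

/-! ### The covariance kernel and its Hölder continuity. -/

section CovarianceKernel

open scoped ENNReal

/-- The Lipschitz bound serves for |s - t| ≤ 1, the trivial bound 2 for |s - t| ≥ 1. -/
theorem norm_exp_I_mul_sub_exp_I_mul_le {β : ℝ} (hβ : 0 < β) (hβ1 : β ≤ 1) (s t : ℝ) :
    ‖Complex.exp (Complex.I * s) - Complex.exp (Complex.I * t)‖ ≤ 2 * |s - t| ^ β := by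
  have h : Complex.exp (Complex.I * s) - Complex.exp (Complex.I * t)
      = Complex.exp (Complex.I * t) * (Complex.exp (Complex.I * (s - t : ℝ)) - 1) := by
    rw [mul_sub, ← Complex.exp_add, mul_one]
    congr 2
    push_cast
    ring
  have hn : ∀ r : ℝ, ‖Complex.exp (Complex.I * r)‖ = 1 := fun r => by
    rw [mul_comm, Complex.norm_exp_ofReal_mul_I]
  rcases le_total |s - t| 1 with h1 | h1
  · rw [h, norm_mul, hn, one_mul]
    refine (Real.norm_exp_I_mul_ofReal_sub_one_le).trans ?_
    rw [Real.norm_eq_abs]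
    have : |s - t| ≤ |s - t| ^ β := by
      simpa using Real.rpow_le_rpow_of_exponent_ge_of_imp (abs_nonneg (s - t)) h1 hβ1
        (fun _ h => absurd h one_ne_zero)
    have : 0 ≤ |s - t| ^ β := by positivity
    linarith
  · refine (norm_sub_le _ _).trans ?_
    rw [hn, hn]
    have := Real.one_le_rpow h1 hβ.le
    linarith

/-- The Schwartz kernel of the operator with symbol `σ` of order less than `-2`. -/
noncomputable def covKernel (σ : Plane → Plane → ℂ) (x y : Plane) : ℂ :=
  (1 / (2 * Real.pi) ^ 2 : ℝ) *
    ∫ ξ, Complex.exp (Complex.I * (inner ℝ x ξ - inner ℝ y ξ : ℝ)) * σ x ξ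

variable {σ : Plane → Plane → ℂ} {m C : ℝ}

theorem HalfSpaceScattering.IsSymbol.continuous_right {a : Plane → Plane → ℂ} (ha : IsSymbol m a) (x : Plane) :
    Continuous (a x) :=
  ha.1.continuous.comp (Continuous.prodMk_right x)

theorem HalfSpaceScattering.IsSymbol.exists_norm_le {a : Plane → Plane → ℂ} (ha : IsSymbol m a) :
    ∃ C : ℝ, 0 ≤ C ∧ ∀ x ξ, ‖a x ξ‖ ≤ C * (1 + ‖ξ‖) ^ m := by
  obtain ⟨C, hC⟩ := ha.2 0 0
  have h : ∀ x ξ, ‖a x ξ‖ ≤ C * (1 + ‖ξ‖) ^ m := fun x ξ => by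
    simpa [norm_iteratedFDeriv_zero] using hC x ξ (Set.mem_univ _)
  refine ⟨C, ?_, h⟩
  simpa using (norm_nonneg _).trans (h 0 0)

theorem integrable_symbol (hm : m < -2) (hc : ∀ x, Continuous (σ x))
    (hσ : ∀ x ξ, ‖σ x ξ‖ ≤ C * (1 + ‖ξ‖) ^ m) (x : Plane) : Integrable (σ x) := by
  have hi := integrable_one_add_norm (E := Plane) (μ := volume) (r := -m)
    (by rw [finrank_euclideanSpace_fin]; push_cast; linarith)
  rw [neg_neg] at hi
  exact (hi.const_mul C).mono' (hc x).aestronglyMeasurable (Filter.Eventually.of_forall (hσ x))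

/-- The difference of exponentials yields |y - y'|^β at the price of β powers of the frequency;
since m + β < -2, the integral over the plane still converges. -/
theorem exists_covKernel_holder (hm : m < -2) (hc : ∀ x, Continuous (σ x)) (hC : 0 ≤ C)
    (hσ : ∀ x ξ, ‖σ x ξ‖ ≤ C * (1 + ‖ξ‖) ^ m) {β : ℝ} (hβ : 0 < β) (hβ1 : β ≤ 1)
    (hβm : m + β < -2) :
    ∃ K : ℝ, 0 ≤ K ∧ ∀ x y y', ‖covKernel σ x y - covKernel σ x y'‖ ≤ K * ‖y - y'‖ ^ β := by
  have hi := integrable_one_add_norm (E := Plane) (μ := volume) (r := -(m + β))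
    (by rw [finrank_euclideanSpace_fin]; push_cast; linarith)
  rw [neg_neg] at hi
  set J := ∫ ξ : Plane, (1 + ‖ξ‖) ^ (m + β) with hJ
  have hJ0 : 0 ≤ J := integral_nonneg fun ξ => by positivity
  have hpi := Real.pi_pos
  refine ⟨1 / (2 * Real.pi) ^ 2 * (2 * C * J), by positivity, fun x y y' => ?_⟩
  have hint : ∀ y, Integrable fun ξ : Plane =>
      Complex.exp (Complex.I * (inner ℝ x ξ - inner ℝ y ξ : ℝ)) * σ x ξ := fun y =>
    (integrable_symbol hm hc hσ x).bdd_mul (c := 1)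
      (by fun_prop) (Filter.Eventually.of_forall fun ξ => by
        rw [mul_comm Complex.I, Complex.norm_exp_ofReal_mul_I])
  rw [covKernel, covKernel, ← mul_sub, norm_mul, Complex.norm_real,
    Real.norm_of_nonneg (by positivity), ← integral_sub (hint y) (hint y')]
  rw [mul_assoc]
  gcongr
  calc _ ≤ ∫ ξ : Plane, 2 * C * ‖y - y'‖ ^ β * (1 + ‖ξ‖) ^ (m + β) := by
        refine norm_integral_le_of_norm_le (hi.const_mul _) (Filter.Eventually.of_forall fun ξ => ?_)
        rw [← sub_mul, norm_mul]
        have h1 := norm_exp_I_mul_sub_exp_I_mul_le hβ hβ1 (inner ℝ x ξ - inner ℝ y ξ)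
          (inner ℝ x ξ - inner ℝ y' ξ)
        have h2 : |(inner ℝ x ξ - inner ℝ y ξ) - (inner ℝ x ξ - inner ℝ y' ξ)|
            ≤ ‖y - y'‖ * (1 + ‖ξ‖) := by
          have e : (inner ℝ x ξ - inner ℝ y ξ) - (inner ℝ x ξ - inner ℝ y' ξ)
              = -inner ℝ (y - y') ξ := by
            rw [inner_sub_left]
            ring
          rw [e, abs_neg]
          refine (abs_real_inner_le_norm _ _).trans ?_
          gcongr
          linarith
        have h3 : (‖y - y'‖ * (1 + ‖ξ‖)) ^ β = ‖y - y'‖ ^ β * (1 + ‖ξ‖) ^ β :=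
          Real.mul_rpow (norm_nonneg _) (by positivity)
        calc _ ≤ 2 * (‖y - y'‖ * (1 + ‖ξ‖)) ^ β * (C * (1 + ‖ξ‖) ^ m) := by
              refine mul_le_mul (h1.trans ?_) (hσ x ξ) (norm_nonneg _) (by positivity)
              gcongr
          _ = _ := by
              rw [h3, Real.rpow_add (by positivity : (0 : ℝ) < 1 + ‖ξ‖)]
              ring
    _ = 2 * C * J * ‖y - y'‖ ^ β := by
        rw [integral_const_mul]
        ring

/-- Fubini, available because a symbol of order below -2 is integrable in ξ. -/
theorem opOfSymbol_eq_integral_covKernel (hm : m < -2) (hc : ∀ x, Continuous (σ x))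
    (hσ : ∀ x ξ, ‖σ x ξ‖ ≤ C * (1 + ‖ξ‖) ^ m) {ψ : Plane → ℝ} (hψ : Integrable ψ) (x : Plane) :
    opOfSymbol σ ψ x = ∫ y, covKernel σ x y * ψ y := by
  have hs := integrable_symbol hm hc hσ x
  have hprod : Integrable (fun q : Plane × Plane =>
      Complex.exp (Complex.I * (inner ℝ x q.1 - inner ℝ q.2 q.1 : ℝ)) * (σ x q.1 * (ψ q.2 : ℂ)))
      (volume.prod volume) := by
    refine (hs.mul_prod hψ.ofReal).bdd_mul (c := 1) ?_ (Filter.Eventually.of_forall fun q => ?_)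
    · exact Continuous.aestronglyMeasurable (by fun_prop)
    · rw [mul_comm Complex.I, Complex.norm_exp_ofReal_mul_I]
  have hexp : ∀ ξ y : Plane, Complex.exp (Complex.I * (inner ℝ x ξ - inner ℝ y ξ : ℝ))
      = Complex.exp (Complex.I * (inner ℝ x ξ : ℝ)) *
        Complex.exp (-(Complex.I * (inner ℝ y ξ : ℝ))) := by
    intro ξ y
    rw [← Complex.exp_add]
    congr 1
    push_cast
    ring
  have hswap := integral_integral_swap
    (f := fun ξ y : Plane => Complex.exp (Complex.I * (inner ℝ x ξ - inner ℝ y ξ : ℝ)) *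
      (σ x ξ * (ψ y : ℂ))) (μ := volume) (ν := volume) hprod
  have h1 : (∫ ξ, Complex.exp (Complex.I * (inner ℝ x ξ : ℝ)) * σ x ξ * fourierHat ψ ξ)
      = ∫ ξ, ∫ y, Complex.exp (Complex.I * (inner ℝ x ξ - inner ℝ y ξ : ℝ)) *
        (σ x ξ * (ψ y : ℂ)) := by
    congr 1 with ξ
    rw [fourierHat, ← integral_const_mul]
    congr 1 with y
    rw [hexp]
    ring
  rw [opOfSymbol, h1, hswap, ← integral_const_mul]
  congr 1 with y
  rw [covKernel, mul_assoc, ← integral_mul_const]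
  congr 2 with ξ
  ring

end CovarianceKernel

/-! ### Gaussian moments. -/

section GaussianMoments

open scoped ENNReal

variable {Ω : Type*} [MeasurableSpace Ω] {P : Measure Ω}

/-- Even moments of centered Gaussian variables are controlled by the variance. -/
theorem exists_lintegral_pow_le (m : ℕ) : ∃ M : ℝ≥0∞, M ≠ ⊤ ∧
    ∀ X : Ω → ℝ, HasGaussianLaw X P → ∫ ω, X ω ∂P = 0 → ∀ V : ℝ, Var[X; P] ≤ V →
      ∫⁻ ω, ENNReal.ofReal (X ω ^ (2 * m)) ∂P ≤ M * ENNReal.ofReal V ^ m := by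
  refine ⟨∫⁻ z, ENNReal.ofReal (z ^ (2 * m)) ∂(gaussianReal 0 1), ?_, ?_⟩
  · have h : MemLp id ((2 * m : ℕ) : NNReal) (gaussianReal 0 1) := memLp_id_gaussianReal _
    have h2 : Integrable (fun z : ℝ => z ^ (2 * m)) (gaussianReal 0 1) := by
      have h3 := MemLp.integrable_norm_pow' (p := 2 * m) (f := id) (μ := gaussianReal 0 1)
        (by exact_mod_cast h)
      refine h3.congr (Filter.Eventually.of_forall fun z => ?_)
      simp [pow_mul]
    exact h2.lintegral_lt_top.ne
  · intro X hX h0 V hV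
    have hm := hX.map_eq_gaussianReal
    rw [h0] at hm
    set v := Var[X; P].toNNReal with hv
    -- A centered Gaussian is √v times a standard one, also in the degenerate case v = 0; so the
    -- standard moment is a universal constant.
    have hmap : gaussianReal 0 v = (gaussianReal 0 1).map (Real.sqrt v * ·) := by
      rw [gaussianReal_map_const_mul]
      congr 1
      · simp
      · ext
        simp
    have hmeas : Measurable fun z : ℝ => ENNReal.ofReal (z ^ (2 * m)) := by fun_prop
    have e1 : ∫⁻ ω, ENNReal.ofReal (X ω ^ (2 * m)) ∂P
        = ∫⁻ z, ENNReal.ofReal (z ^ (2 * m)) ∂(P.map X) :=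
      (lintegral_map' hmeas.aemeasurable hX.aemeasurable).symm
    rw [e1, hm, hmap, lintegral_map hmeas (by fun_prop), ← lintegral_mul_const _ hmeas]
    refine lintegral_mono fun z => ?_
    rw [← ENNReal.ofReal_pow (le_trans (variance_nonneg X P) hV),
      ← ENNReal.ofReal_mul (by rw [pow_mul]; positivity)]
    refine ENNReal.ofReal_le_ofReal ?_
    rw [mul_pow, pow_mul (Real.sqrt v), Real.sq_sqrt (NNReal.coe_nonneg v), mul_comm]
    have : (v : ℝ) ≤ V := by
      rw [hv, Real.coe_toNNReal _ (variance_nonneg X P)]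
      exact hV
    have h4 : 0 ≤ z ^ (2 * m) := by rw [pow_mul]; positivity
    gcongr

end GaussianMoments

/-! ### Variance bounds from the covariance kernel. -/

section VarianceBounds

open scoped ENNReal

variable {Ω : Type*} [MeasurableSpace Ω] {P : Measure Ω}
  {lam : Ω → 𝓓'((⊤ : Opens Plane), ℝ)} {σ : Plane → Plane → ℂ} {m C : ℝ}

theorem TestFunction.integrable_plane (ψ : 𝓓((⊤ : Opens Plane), ℝ)) : Integrable ψ :=
  ψ.continuous.integrable_of_hasCompactSupport ψ.hasCompactSupport

/-- The variance of `⟨lam, ψ⟩` in terms of the covariance kernel. -/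
theorem variance_le_of_norm_integral_covKernel_le (hm : m < -2) (hc : ∀ x, Continuous (σ x))
    (hσ : ∀ x ξ, ‖σ x ξ‖ ≤ C * (1 + ‖ξ‖) ^ m)
    (h_gauss : IsGaussianField P lam) (hcov : HasCovarianceSymbol P lam σ)
    (ψ : 𝓓((⊤ : Opens Plane), ℝ)) {B : ℝ}
    (hB : ∀ x, ‖∫ y, covKernel σ x y * ψ y‖ ≤ B) :
    Var[fun ω => lam ω ψ; P] ≤ (∫ x, |ψ x|) * B := by
  have h := hcov ψ ψ
  rw [covariance_self (h_gauss.measurable ψ).aemeasurable] at h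
  have hn := congrArg norm h
  rw [Complex.norm_real, Real.norm_of_nonneg (variance_nonneg _ _)] at hn
  rw [hn, ← integral_mul_const]
  refine norm_integral_le_of_norm_le (ψ.integrable_plane.abs.mul_const B)
    (Filter.Eventually.of_forall fun x => ?_)
  rw [norm_mul, Complex.norm_real, Real.norm_eq_abs,
    opOfSymbol_eq_integral_covKernel hm hc hσ ψ.integrable_plane]
  gcongr
  exact hB x

end VarianceBounds

/-! ### Mollifiers tested against Hölder functions. -/

section Mollifier

open scoped ENNReal

/-- The smooth bump at `a` of scale `2⁻ⁿ`. -/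
noncomputable def mollifierBump (n : ℕ) (a : Plane) : ContDiffBump a where
  rIn := (1 / 2 : ℝ) ^ n / 2
  rOut := (1 / 2 : ℝ) ^ n
  rIn_pos := by positivity
  rIn_lt_rOut := half_lt_self (by positivity)

/-- The normalized bump at `a` of scale `2⁻ⁿ`, as a test function. -/
noncomputable def mollifier (n : ℕ) (a : Plane) : 𝓓((⊤ : Opens Plane), ℝ) where
  toFun := (mollifierBump n a).normed volume
  contDiff' := (mollifierBump n a).contDiff_normed
  hasCompactSupport' := (mollifierBump n a).hasCompactSupport_normed
  tsupport_subset' := fun _ _ => trivial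

theorem mollifier_nonneg (n : ℕ) (a x : Plane) : 0 ≤ mollifier n a x :=
  (mollifierBump n a).nonneg_normed x

theorem integral_mollifier (n : ℕ) (a : Plane) : ∫ x, mollifier n a x = 1 :=
  (mollifierBump n a).integral_normed

theorem integral_abs_mollifier (n : ℕ) (a : Plane) : ∫ x, |mollifier n a x| = 1 := by
  simp_rw [abs_of_nonneg (mollifier_nonneg n a _)]
  exact integral_mollifier n a

theorem norm_sub_lt_of_mollifier_ne_zero {n : ℕ} {a x : Plane} (h : mollifier n a x ≠ 0) :
    ‖x - a‖ < (1 / 2 : ℝ) ^ n := by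
  have : x ∈ Function.support ((mollifierBump n a).normed volume) := h
  rwa [ContDiffBump.support_normed_eq, mem_ball_iff_norm] at this

variable {h : Plane → ℂ} {K β : ℝ}

theorem continuous_of_norm_sub_le_rpow (hβ : 0 < β)
    (hh : ∀ y y', ‖h y - h y'‖ ≤ K * ‖y - y'‖ ^ β) : Continuous h := by
  refine continuous_iff_continuousAt.2 fun y₀ => ?_
  refine tendsto_iff_norm_sub_tendsto_zero.2 ?_
  refine squeeze_zero (fun _ => norm_nonneg _) (fun y => hh y y₀) ?_
  have hc : ContinuousAt (fun y : Plane => K * ‖y - y₀‖ ^ β) y₀ :=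
    continuousAt_const.mul ((continuous_id.sub continuous_const).norm.continuousAt.rpow_const
      (Or.inr hβ.le))
  have := hc.tendsto
  simpa [Real.zero_rpow hβ.ne'] using this

theorem TestFunction.integrable_mul_of_continuous (hc : Continuous h)
    (ψ : 𝓓((⊤ : Opens Plane), ℝ)) : Integrable fun y => h y * (ψ y : ℂ) := by
  refine Continuous.integrable_of_hasCompactSupport
    (hc.mul (Complex.continuous_ofReal.comp ψ.continuous)) ?_
  exact (ψ.hasCompactSupport.comp_left (g := ((↑) : ℝ → ℂ)) rfl).mul_left

theorem norm_integral_mul_mollifier_sub_le (hK : 0 ≤ K) (hβ : 0 < β)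
    (hh : ∀ y y', ‖h y - h y'‖ ≤ K * ‖y - y'‖ ^ β) (n : ℕ) (a : Plane) :
    ‖(∫ y, h y * (mollifier n a y : ℂ)) - h a‖ ≤ K * ((1 / 2 : ℝ) ^ n) ^ β := by
  have hc := continuous_of_norm_sub_le_rpow hβ hh
  have hi := TestFunction.integrable_mul_of_continuous hc (mollifier n a)
  have e : h a = ∫ y, h a * (mollifier n a y : ℂ) := by
    rw [integral_const_mul, integral_complex_ofReal, integral_mollifier]
    simp
  rw [e, ← integral_sub hi (TestFunction.integrable_mul_of_continuous continuous_const _)]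
  calc _ ≤ ∫ y, K * ((1 / 2 : ℝ) ^ n) ^ β * mollifier n a y := by
        refine norm_integral_le_of_norm_le ((mollifier n a).integrable_plane.const_mul _)
          (Filter.Eventually.of_forall fun y => ?_)
        rw [← sub_mul, norm_mul, Complex.norm_real, Real.norm_of_nonneg (mollifier_nonneg n a y)]
        by_cases hy : mollifier n a y = 0
        · simp [hy]
        · have := norm_sub_lt_of_mollifier_ne_zero hy
          have := mollifier_nonneg n a y
          refine mul_le_mul_of_nonneg_right ((hh y a).trans ?_) this
          gcongr
    _ = _ := by rw [integral_const_mul, integral_mollifier, mul_one]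

theorem norm_integral_mul_mollifier_sub_mollifier_le (hK : 0 ≤ K) (hβ : 0 < β)
    (hh : ∀ y y', ‖h y - h y'‖ ≤ K * ‖y - y'‖ ^ β) (n m : ℕ) (a b : Plane) :
    ‖∫ y, h y * ((mollifier n a - mollifier m b) y : ℂ)‖ ≤
      K * (((1 / 2 : ℝ) ^ n) ^ β + ((1 / 2 : ℝ) ^ m) ^ β + ‖a - b‖ ^ β) := by
  have hc := continuous_of_norm_sub_le_rpow hβ hh
  have e : ∫ y, h y * ((mollifier n a - mollifier m b) y : ℂ)
      = (∫ y, h y * (mollifier n a y : ℂ)) - ∫ y, h y * (mollifier m b y : ℂ) := by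
    rw [← integral_sub (TestFunction.integrable_mul_of_continuous hc _)
      (TestFunction.integrable_mul_of_continuous hc _)]
    congr 1 with y
    rw [sub_apply]
    push_cast
    ring
  have h1 := norm_integral_mul_mollifier_sub_le hK hβ hh n a
  have h2 := norm_integral_mul_mollifier_sub_le hK hβ hh m b
  have h3 := hh a b
  rw [e, show (∫ y, h y * (mollifier n a y : ℂ)) - ∫ y, h y * (mollifier m b y : ℂ)
    = ((∫ y, h y * (mollifier n a y : ℂ)) - h a) - ((∫ y, h y * (mollifier m b y : ℂ)) - h b)
      + (h a - h b) by ring]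
  refine (norm_add_le _ _).trans ?_
  have := norm_sub_le ((∫ y, h y * (mollifier n a y : ℂ)) - h a)
    ((∫ y, h y * (mollifier m b y : ℂ)) - h b)
  linarith

end Mollifier

/-! ### Dyadic grids in the plane. -/

section Grid

open scoped ENNReal

/-- The point of the grid `2⁻ⁿ ℤ²` with index `j`. -/
noncomputable def gridPoint (n : ℕ) (j : ℤ × ℤ) : Plane :=
  !₂[(j.1 : ℝ) * (1 / 2) ^ n, (j.2 : ℝ) * (1 / 2) ^ n]

/-- The index of the cell of the grid `2⁻ⁿ ℤ²` containing `x`. -/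
noncomputable def gridIndex (n : ℕ) (x : Plane) : ℤ × ℤ := (⌊x 0 * 2 ^ n⌋, ⌊x 1 * 2 ^ n⌋)

theorem norm_plane_le (x : Plane) : ‖x‖ ≤ |x 0| + |x 1| := by
  rw [EuclideanSpace.norm_eq, Real.sqrt_le_left (by positivity)]
  simp only [Fin.sum_univ_two, Real.norm_eq_abs]
  nlinarith [abs_nonneg (x 0), abs_nonneg (x 1)]

theorem abs_apply_le_norm (x : Plane) (i : Fin 2) : |x i| ≤ ‖x‖ := PiLp.norm_apply_le x i

theorem half_pow_mul_two_pow (n : ℕ) : (1 / 2 : ℝ) ^ n * 2 ^ n = 1 := by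
  rw [← mul_pow]
  norm_num

theorem norm_sub_gridPoint_gridIndex_le (n : ℕ) (x : Plane) :
    ‖x - gridPoint n (gridIndex n x)‖ ≤ 2 * (1 / 2 : ℝ) ^ n := by
  have key : ∀ t : ℝ, |t - (⌊t * 2 ^ n⌋ : ℝ) * (1 / 2) ^ n| ≤ (1 / 2 : ℝ) ^ n := by
    intro t
    have h1 := Int.floor_le (t * 2 ^ n)
    have h2 := Int.lt_floor_add_one (t * 2 ^ n)
    have hp : (0 : ℝ) < (1 / 2) ^ n := by positivity
    have e : t = t * 2 ^ n * (1 / 2) ^ n := by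
      rw [mul_assoc, mul_comm ((2 : ℝ) ^ n), half_pow_mul_two_pow, mul_one]
    rw [abs_le]
    constructor <;> nlinarith
  refine (norm_plane_le _).trans ?_
  have h0 := key (x 0)
  have h1 := key (x 1)
  simp only [gridPoint, gridIndex, PiLp.sub_apply]
  simp only [Matrix.cons_val_zero, Matrix.cons_val_one]
  linarith

theorem norm_gridPoint_sub_le (n : ℕ) (i j : ℤ × ℤ) :
    ‖gridPoint n i - gridPoint n j‖ ≤ (|(i.1 : ℝ) - j.1| + |(i.2 : ℝ) - j.2|) * (1 / 2 : ℝ) ^ n := by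
  refine (norm_plane_le _).trans (le_of_eq ?_)
  have hp : (0 : ℝ) ≤ (1 / 2) ^ n := by positivity
  simp only [gridPoint, PiLp.sub_apply]
  simp only [Matrix.cons_val_zero, Matrix.cons_val_one]
  rw [← sub_mul, ← sub_mul, abs_mul, abs_mul, abs_of_nonneg hp]
  ring

theorem gridPoint_succ (n : ℕ) (j : ℤ × ℤ) :
    gridPoint (n + 1) (2 * j.1, 2 * j.2) = gridPoint n j := by
  simp only [gridPoint]
  push_cast
  rw [pow_succ]
  congr 2
  · ring
  · ext
    ring_nf

/-- The neighbours of a grid index. -/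
noncomputable def gridNeighbours : Finset (ℤ × ℤ) := Finset.Icc (-1) 1 ×ˢ Finset.Icc (-1) 1

/-- The floor of 2t is twice the floor of t plus 0 or 1. The symmetric set of offsets is larger than
necessary, but it serves both kinds of increments in the chaining. -/
theorem gridIndex_succ (n : ℕ) (x : Plane) : ∃ e ∈ gridNeighbours,
    gridIndex (n + 1) x = (2 * (gridIndex n x).1 + e.1, 2 * (gridIndex n x).2 + e.2) := by
  have key : ∀ t : ℝ, ∃ e ∈ Finset.Icc (-1 : ℤ) 1, ⌊t * 2 ^ (n + 1)⌋ = 2 * ⌊t * 2 ^ n⌋ + e := by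
    intro t
    refine ⟨⌊t * 2 ^ (n + 1)⌋ - 2 * ⌊t * 2 ^ n⌋, ?_, by ring⟩
    have h1 := Int.floor_le (t * 2 ^ n)
    have h2 := Int.lt_floor_add_one (t * 2 ^ n)
    have e : t * 2 ^ (n + 1) = 2 * (t * 2 ^ n) := by ring
    have h3 : 2 * ⌊t * 2 ^ n⌋ ≤ ⌊t * 2 ^ (n + 1)⌋ := Int.le_floor.2 (by push_cast; linarith)
    have h4 : ⌊t * 2 ^ (n + 1)⌋ < 2 * ⌊t * 2 ^ n⌋ + 2 := Int.floor_lt.2 (by push_cast; linarith)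
    rw [Finset.mem_Icc]
    constructor <;> linarith
  obtain ⟨e0, h0, k0⟩ := key (x 0)
  obtain ⟨e1, h1, k1⟩ := key (x 1)
  exact ⟨(e0, e1), Finset.mem_product.2 ⟨h0, h1⟩, Prod.ext k0 k1⟩

theorem gridIndex_of_norm_sub_le {n : ℕ} {x y : Plane} (h : ‖x - y‖ ≤ (1 / 2 : ℝ) ^ n) :
    ∃ e ∈ gridNeighbours, gridIndex n y = gridIndex n x + e := by
  have key : ∀ i : Fin 2, ∃ e ∈ Finset.Icc (-1 : ℤ) 1, ⌊y i * 2 ^ n⌋ = ⌊x i * 2 ^ n⌋ + e := by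
    intro i
    refine ⟨⌊y i * 2 ^ n⌋ - ⌊x i * 2 ^ n⌋, ?_, by ring⟩
    have h1 : |x i - y i| ≤ (1 / 2 : ℝ) ^ n := (abs_apply_le_norm (x - y) i).trans h
    have hp : (0 : ℝ) < 2 ^ n := by positivity
    have h2 : |x i * 2 ^ n - y i * 2 ^ n| ≤ 1 := by
      rw [← sub_mul, abs_mul, abs_of_pos hp, ← half_pow_mul_two_pow n]
      gcongr
    obtain ⟨h3, h4⟩ := abs_le.1 h2
    have a1 := Int.floor_le (x i * 2 ^ n)
    have a2 := Int.lt_floor_add_one (x i * 2 ^ n)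
    have b1 := Int.floor_le (y i * 2 ^ n)
    have b2 := Int.lt_floor_add_one (y i * 2 ^ n)
    have c1 : ⌊y i * 2 ^ n⌋ < ⌊x i * 2 ^ n⌋ + 2 := Int.floor_lt.2 (by push_cast; linarith)
    have c2 : ⌊x i * 2 ^ n⌋ < ⌊y i * 2 ^ n⌋ + 2 := Int.floor_lt.2 (by push_cast; linarith)
    rw [Finset.mem_Icc]
    constructor <;> linarith
  obtain ⟨e0, h0, k0⟩ := key 0
  obtain ⟨e1, h1, k1⟩ := key 1
  exact ⟨(e0, e1), Finset.mem_product.2 ⟨h0, h1⟩, Prod.ext k0 k1⟩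

/-- The indices of the cells of `2⁻ⁿ ℤ²` that meet the ball of radius `N`. -/
noncomputable def gridBox (N n : ℕ) : Finset (ℤ × ℤ) :=
  Finset.Icc (-(N * 2 ^ n : ℤ)) (N * 2 ^ n) ×ˢ Finset.Icc (-(N * 2 ^ n : ℤ)) (N * 2 ^ n)

theorem gridIndex_mem_gridBox {N : ℕ} {x : Plane} (hx : ‖x‖ ≤ N) (n : ℕ) :
    gridIndex n x ∈ gridBox N n := by
  have key : ∀ i, ⌊x i * 2 ^ n⌋ ∈ Finset.Icc (-(N * 2 ^ n : ℤ)) (N * 2 ^ n) := by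
    intro i
    obtain ⟨h1, h2⟩ := abs_le.1 ((abs_apply_le_norm x i).trans hx)
    have hp : (0 : ℝ) < 2 ^ n := by positivity
    rw [Finset.mem_Icc]
    constructor
    · refine Int.le_floor.2 ?_
      push_cast
      nlinarith
    · have : ((⌊x i * 2 ^ n⌋ : ℤ) : ℝ) ≤ (N * 2 ^ n : ℤ) := by
        refine (Int.floor_le _).trans ?_
        push_cast
        nlinarith
      exact_mod_cast this
  exact Finset.mem_product.2 ⟨key 0, key 1⟩

theorem card_gridBox_le (N n : ℕ) : ((gridBox N n).card : ℝ) ≤ (2 * N + 1) ^ 2 * 4 ^ n := by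
  have h : (gridBox N n).card = (2 * (N * 2 ^ n) + 1) * (2 * (N * 2 ^ n) + 1) := by
    rw [gridBox, Finset.card_product, Int.card_Icc]
    have : (N * 2 ^ n + 1 - -(N * 2 ^ n : ℤ)).toNat = 2 * (N * 2 ^ n) + 1 := by
      have e : (N * 2 ^ n + 1 - -(N * 2 ^ n : ℤ)) = ((2 * (N * 2 ^ n) + 1 : ℕ) : ℤ) := by
        push_cast
        ring
      rw [e, Int.toNat_natCast]
    rw [this]
  rw [h]
  have h2 : (2 * (N * 2 ^ n) + 1 : ℝ) ≤ (2 * N + 1) * 2 ^ n := by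
    have : (1 : ℝ) ≤ 2 ^ n := one_le_pow₀ (by norm_num)
    linarith
  push_cast
  calc ((2 * (N * 2 ^ n) + 1) * (2 * (N * 2 ^ n) + 1) : ℝ)
      ≤ ((2 * N + 1) * 2 ^ n) * ((2 * N + 1) * 2 ^ n) := by gcongr
    _ = (2 * N + 1) ^ 2 * 4 ^ n := by
        rw [show (4 : ℝ) = 2 * 2 by norm_num, mul_pow]
        ring

theorem measurable_gridIndex (n : ℕ) : Measurable (gridIndex n) := by
  unfold gridIndex
  fun_prop

/-- Integration of a function that is constant on grid cells. -/
theorem integral_smul_comp_gridIndex {E : Type*} [NormedAddCommGroup E] [NormedSpace ℝ E]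
    [CompleteSpace E] {φ : Plane → ℝ} (hφ : Integrable φ) (n : ℕ) {J : Finset (ℤ × ℤ)}
    (hJ : ∀ x, φ x ≠ 0 → gridIndex n x ∈ J) (F : ℤ × ℤ → E) :
    Integrable (fun x => φ x • F (gridIndex n x)) ∧
    ∫ x, φ x • F (gridIndex n x) = ∑ j ∈ J, (∫ x in gridIndex n ⁻¹' {j}, φ x) • F j := by
  have hm : ∀ j : ℤ × ℤ, MeasurableSet (gridIndex n ⁻¹' {j}) := fun j =>
    measurable_gridIndex n (measurableSet_singleton j)
  have e : (fun x => φ x • F (gridIndex n x))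
      = fun x => ∑ j ∈ J, (gridIndex n ⁻¹' {j}).indicator (fun x => φ x • F j) x := by
    ext x
    by_cases hx : φ x = 0
    · rw [hx, zero_smul, Finset.sum_eq_zero]
      intro j _
      rw [Set.indicator_apply_eq_zero]
      intro _
      simp [hx]
    · rw [Finset.sum_eq_single_of_mem _ (hJ x hx)]
      · rw [Set.indicator_of_mem (by rfl)]
      · intro j _ hj
        exact Set.indicator_of_notMem (fun h => hj h.symm) _
  have hi : ∀ j ∈ J, Integrable ((gridIndex n ⁻¹' {j}).indicator fun x => φ x • F j) :=
    fun j _ => (hφ.smul_const (F j)).indicator (hm j)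
  rw [e]
  refine ⟨integrable_finsetSum _ hi, ?_⟩
  rw [integral_finsetSum _ hi]
  refine Finset.sum_congr rfl fun j _ => ?_
  rw [integral_indicator (hm j), integral_smul_const]

end Grid

/-! ### Approximation of test functions by bumps on a grid. -/

section StepApproximation

open Filter
open scoped ENNReal Topology

/-- The approximation of a test function by bumps at the grid points of `2⁻ⁿ ℤ²`. -/
noncomputable def gridApprox (n : ℕ) (J : Finset (ℤ × ℤ)) (φ : Plane → ℝ) :
    𝓓((⊤ : Opens Plane), ℝ) :=
  ∑ j ∈ J, (∫ x in gridIndex n ⁻¹' {j}, φ x) • mollifier n (gridPoint n j)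

theorem gridApprox_apply (n : ℕ) (J : Finset (ℤ × ℤ)) (φ : Plane → ℝ) (y : Plane) :
    gridApprox n J φ y =
      ∑ j ∈ J, (∫ x in gridIndex n ⁻¹' {j}, φ x) * mollifier n (gridPoint n j) y := by
  have h : ∀ s : Finset (ℤ × ℤ), (∑ j ∈ s, (∫ x in gridIndex n ⁻¹' {j}, φ x) •
      mollifier n (gridPoint n j)) y =
      ∑ j ∈ s, (∫ x in gridIndex n ⁻¹' {j}, φ x) * mollifier n (gridPoint n j) y := by
    intro s
    induction s using Finset.cons_induction with
    | empty => rfl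
    | cons a s ha ih => rw [Finset.sum_cons, Finset.sum_cons, add_apply, ih]; rfl
  exact h J

variable {φ : 𝓓((⊤ : Opens Plane), ℝ)} {n : ℕ} {J : Finset (ℤ × ℤ)}

/-- The bumps are nonnegative of mass one and each carries the integral of φ over its cell. The
bound keeps the variance estimate for the approximation error uniform in n. -/
theorem integral_abs_gridApprox_le (hJ : ∀ x, φ x ≠ 0 → gridIndex n x ∈ J) :
    ∫ y, |gridApprox n J φ y| ≤ ∫ x, |φ x| := by
  have h1 := (integral_smul_comp_gridIndex (φ := fun x => |φ x|) φ.integrable_plane.abs n (J := J)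
    (fun x hx => hJ x (by simpa using hx)) (fun _ => (1 : ℝ))).2
  simp only [smul_eq_mul, mul_one] at h1
  rw [h1]
  have hi : ∀ j ∈ J, Integrable fun y => |∫ x in gridIndex n ⁻¹' {j}, φ x| *
      mollifier n (gridPoint n j) y := fun j _ => (mollifier _ _).integrable_plane.const_mul _
  calc ∫ y, |gridApprox n J φ y|
      ≤ ∫ y, ∑ j ∈ J, |∫ x in gridIndex n ⁻¹' {j}, φ x| * mollifier n (gridPoint n j) y := by
        refine integral_mono (gridApprox n J φ).integrable_plane.abs (integrable_finsetSum _ hi)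
          fun y => ?_
        simp only [gridApprox_apply]
        refine (Finset.abs_sum_le_sum_abs _ _).trans (Finset.sum_le_sum fun j _ => ?_)
        rw [abs_mul, abs_of_nonneg (mollifier_nonneg n _ y)]
    _ = ∑ j ∈ J, |∫ x in gridIndex n ⁻¹' {j}, φ x| := by
        rw [integral_finsetSum _ hi]
        refine Finset.sum_congr rfl fun j _ => ?_
        rw [integral_const_mul, integral_mollifier, mul_one]
    _ ≤ _ := Finset.sum_le_sum fun j _ => abs_integral_le_integral_abs

/-- Mass at x moves by at most 2·2⁻ⁿ to its grid point and then by 2⁻ⁿ within the bump; as 2^β ≤ 2,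
the Hölder costs add up to the factor 3. -/
theorem norm_integral_mul_sub_gridApprox_le (hJ : ∀ x, φ x ≠ 0 → gridIndex n x ∈ J)
    {h : Plane → ℂ} {K β : ℝ} (hK : 0 ≤ K) (hβ : 0 < β) (hβ1 : β ≤ 1)
    (hh : ∀ y y', ‖h y - h y'‖ ≤ K * ‖y - y'‖ ^ β) :
    ‖∫ y, h y * ((φ - gridApprox n J φ) y : ℂ)‖ ≤
      3 * K * ((1 / 2 : ℝ) ^ n) ^ β * ∫ x, |φ x| := by
  have hc := continuous_of_norm_sub_le_rpow hβ hh
  set F : ℤ × ℤ → ℂ := fun j => ∫ y, h y * (mollifier n (gridPoint n j) y : ℂ) with hF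
  obtain ⟨i1, e1⟩ := integral_smul_comp_gridIndex φ.integrable_plane n hJ F
  have e2 : ∫ y, h y * (gridApprox n J φ y : ℂ) = ∫ x, φ x • F (gridIndex n x) := by
    rw [e1]
    have : ∀ y, h y * (gridApprox n J φ y : ℂ) = ∑ j ∈ J,
        (∫ x in gridIndex n ⁻¹' {j}, φ x) • (h y * (mollifier n (gridPoint n j) y : ℂ)) := by
      intro y
      rw [gridApprox_apply]
      push_cast
      rw [Finset.mul_sum]
      refine Finset.sum_congr rfl fun j _ => ?_
      rw [Complex.real_smul]
      ring
    simp_rw [this]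
    rw [integral_finsetSum]
    · exact Finset.sum_congr rfl fun j _ => integral_smul _ _
    · intro j _
      exact (TestFunction.integrable_mul_of_continuous hc _).smul (∫ x in gridIndex n ⁻¹' {j}, φ x)
  have i2 := TestFunction.integrable_mul_of_continuous hc φ
  have e3 : ∫ y, h y * ((φ - gridApprox n J φ) y : ℂ)
      = ∫ x, (h x * (φ x : ℂ) - φ x • F (gridIndex n x)) := by
    rw [integral_sub i2 i1, ← e2, ← integral_sub i2 (TestFunction.integrable_mul_of_continuous hc _)]
    congr 1 with y
    rw [sub_apply]
    push_cast
    ring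
  rw [e3, ← integral_const_mul]
  refine norm_integral_le_of_norm_le (φ.integrable_plane.abs.const_mul _)
    (Eventually.of_forall fun x => ?_)
  have h1 := norm_integral_mul_mollifier_sub_le hK hβ hh n (gridPoint n (gridIndex n x))
  have h2 := hh x (gridPoint n (gridIndex n x))
  have h3 : ‖x - gridPoint n (gridIndex n x)‖ ^ β ≤ 2 * ((1 / 2 : ℝ) ^ n) ^ β := by
    have hp : (0 : ℝ) ≤ (1 / 2) ^ n := by positivity
    calc _ ≤ (2 * (1 / 2 : ℝ) ^ n) ^ β := by
          gcongr
          exact norm_sub_gridPoint_gridIndex_le n x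
      _ = 2 ^ β * ((1 / 2 : ℝ) ^ n) ^ β := Real.mul_rpow (by norm_num) hp
      _ ≤ _ := by
          gcongr
          calc (2 : ℝ) ^ β ≤ 2 ^ (1 : ℝ) := Real.rpow_le_rpow_of_exponent_le (by norm_num) hβ1
            _ = 2 := Real.rpow_one 2
  have h4 : ‖h x - F (gridIndex n x)‖ ≤ 3 * K * ((1 / 2 : ℝ) ^ n) ^ β := by
    have e : h x - F (gridIndex n x) = (h x - h (gridPoint n (gridIndex n x)))
        - (F (gridIndex n x) - h (gridPoint n (gridIndex n x))) := by ring
    rw [e]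
    refine (norm_sub_le _ _).trans ?_
    nlinarith [mul_le_mul_of_nonneg_left h3 hK]
  have e5 : h x * (φ x : ℂ) - φ x • F (gridIndex n x) = (h x - F (gridIndex n x)) * (φ x : ℂ) := by
    rw [Complex.real_smul]
    ring
  rw [e5, norm_mul, Complex.norm_real, Real.norm_eq_abs]
  gcongr

end StepApproximation

/-! ### Hölder continuous limits of grid functions. -/

section HolderLimit

open Filter
open scoped ENNReal Topology

/-- Limits of grid functions with geometrically small increments are locally Hölder continuous. -/
theorem exists_holder_limit {F : ℕ → ℤ × ℤ → ℝ} {A : ℕ → ℝ} {γ : ℝ} (hγ : 0 < γ) (hγ1 : γ ≤ 1)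
    (hA : ∀ N, 0 ≤ A N)
    (h0 : ∀ N, ∀ j ∈ gridBox N 0, |F 0 j| ≤ A N)
    (h1 : ∀ N n, ∀ j ∈ gridBox N n, ∀ e ∈ gridNeighbours,
      |F n (j + e) - F n j| ≤ A N * ((1 / 2 : ℝ) ^ γ) ^ n)
    (h2 : ∀ N n, ∀ j ∈ gridBox N n, ∀ e ∈ gridNeighbours,
      |F (n + 1) (2 * j.1 + e.1, 2 * j.2 + e.2) - F n j| ≤ A N * ((1 / 2 : ℝ) ^ γ) ^ n) :
    ∃ ℓ : Plane → ℝ,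
      (∀ (N n : ℕ) (x : Plane), ‖x‖ ≤ N →
        |F n (gridIndex n x) - ℓ x| ≤
          A N * ((1 / 2 : ℝ) ^ γ) ^ n / (1 - (1 / 2 : ℝ) ^ γ)) ∧
      (∀ (N : ℕ) (x : Plane), ‖x‖ ≤ N → |ℓ x| ≤ A N * (1 + (1 - (1 / 2 : ℝ) ^ γ)⁻¹)) ∧
      (∀ (N : ℕ) (x y : Plane), ‖x‖ ≤ N → ‖y‖ ≤ N → ‖x - y‖ ≤ 1 →
        |ℓ x - ℓ y| ≤ A N * (2 + 4 * (1 - (1 / 2 : ℝ) ^ γ)⁻¹) * ‖x - y‖ ^ γ) := by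
  set r := (1 / 2 : ℝ) ^ γ with hr
  have hr0 : 0 < r := by positivity
  have hr1 : r < 1 := Real.rpow_lt_one (by norm_num) (by norm_num) hγ
  have hr1' : 0 < 1 - r := by linarith
  have hstep : ∀ (N : ℕ) (x : Plane), ‖x‖ ≤ N → ∀ n,
      dist (F n (gridIndex n x)) (F (n + 1) (gridIndex (n + 1) x)) ≤ A N * r ^ n := by
    intro N x hx n
    obtain ⟨e, he, hi⟩ := gridIndex_succ n x
    rw [hi, dist_comm, Real.dist_eq]
    exact h2 N n _ (gridIndex_mem_gridBox hx n) e he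
  have hball : ∀ x : Plane, ∃ N : ℕ, ‖x‖ ≤ N := fun x => exists_nat_ge _
  have hlim : ∀ x : Plane, ∃ a, Tendsto (fun n => F n (gridIndex n x)) atTop (𝓝 a) := by
    intro x
    obtain ⟨N, hN⟩ := hball x
    exact cauchySeq_tendsto_of_complete (cauchySeq_of_le_geometric r (A N) hr1 (hstep N x hN))
  choose ℓ hℓ using hlim
  have happ : ∀ (N n : ℕ) (x : Plane), ‖x‖ ≤ N →
      |F n (gridIndex n x) - ℓ x| ≤ A N * r ^ n / (1 - r) := fun N n x hx =>
    dist_le_of_le_geometric_of_tendsto r (A N) hr1 (hstep N x hx) (hℓ x) n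
  refine ⟨ℓ, happ, fun N x hx => ?_, fun N x y hx hy hxy => ?_⟩
  · have a1 := happ N 0 x hx
    have a2 := h0 N _ (gridIndex_mem_gridBox hx 0)
    rw [pow_zero, mul_one] at a1
    calc |ℓ x| = |F 0 (gridIndex 0 x) - (F 0 (gridIndex 0 x) - ℓ x)| := by ring_nf
      _ ≤ |F 0 (gridIndex 0 x)| + |F 0 (gridIndex 0 x) - ℓ x| := abs_sub _ _
      _ ≤ A N + A N / (1 - r) := by linarith
      _ = _ := by ring
  · rcases eq_or_ne x y with rfl | hne
    · simp [Real.zero_rpow hγ.ne']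
    have hpos : 0 < ‖x - y‖ := norm_pos_iff.2 (sub_ne_zero.2 hne)
    -- The level with 2^{-(n+1)} < ‖x - y‖ ≤ 2⁻ⁿ: the points lie in equal or adjacent cells, while
    -- r^n is still comparable to ‖x - y‖^γ.
    obtain ⟨n, hn1, hn2⟩ := exists_nat_pow_near_of_lt_one hpos hxy (by norm_num : (0 : ℝ) < 1 / 2)
      (by norm_num)
    obtain ⟨e, he, hi⟩ := gridIndex_of_norm_sub_le hn2
    have a1 := happ N n x hx
    have a2 := happ N n y hy
    have a3 := h1 N n _ (gridIndex_mem_gridBox hx n) e he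
    rw [← hi] at a3
    have hrn : r ^ n ≤ 2 * ‖x - y‖ ^ γ := by
      have : r ^ n = ((1 / 2 : ℝ) ^ n) ^ γ := by
        rw [hr, ← Real.rpow_natCast, ← Real.rpow_mul (by norm_num), mul_comm, Real.rpow_mul (by norm_num),
          Real.rpow_natCast]
      rw [this]
      calc ((1 / 2 : ℝ) ^ n) ^ γ ≤ (2 * ‖x - y‖) ^ γ := by
            gcongr
            rw [pow_succ] at hn1
            linarith
        _ = 2 ^ γ * ‖x - y‖ ^ γ := Real.mul_rpow (by norm_num) (norm_nonneg _)
        _ ≤ 2 * ‖x - y‖ ^ γ := by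
            gcongr
            calc (2 : ℝ) ^ γ ≤ 2 ^ (1 : ℝ) := Real.rpow_le_rpow_of_exponent_le (by norm_num) hγ1
              _ = 2 := Real.rpow_one 2
    have tri : |ℓ x - ℓ y| ≤ |F n (gridIndex n x) - ℓ x| + |F n (gridIndex n y) - F n (gridIndex n x)|
        + |F n (gridIndex n y) - ℓ y| := by
      have e : ℓ x - ℓ y = -(F n (gridIndex n x) - ℓ x)
          + -(F n (gridIndex n y) - F n (gridIndex n x)) + (F n (gridIndex n y) - ℓ y) := by ring
      rw [e]
      refine (abs_add_three _ _ _).trans ?_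
      rw [abs_neg, abs_neg]
    have hA0 := hA N
    calc |ℓ x - ℓ y| ≤ A N * (1 + 2 * (1 - r)⁻¹) * r ^ n := by
          refine tri.trans ((add_le_add (add_le_add a1 a3) a2).trans (le_of_eq ?_))
          ring
      _ ≤ A N * (1 + 2 * (1 - r)⁻¹) * (2 * ‖x - y‖ ^ γ) := by
          gcongr
      _ = _ := by ring

theorem continuous_of_locally_holder {ℓ : Plane → ℝ} {B : ℕ → ℝ} {γ : ℝ} (hγ : 0 < γ)
    (h : ∀ (N : ℕ) (x y : Plane), ‖x‖ ≤ N → ‖y‖ ≤ N → ‖x - y‖ ≤ 1 →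
      |ℓ x - ℓ y| ≤ B N * ‖x - y‖ ^ γ) : Continuous ℓ := by
  refine continuous_iff_continuousAt.2 fun y => ?_
  obtain ⟨N, hN⟩ := exists_nat_ge (‖y‖ + 1)
  refine tendsto_iff_norm_sub_tendsto_zero.2 ?_
  have hc : Tendsto (fun x : Plane => B N * ‖x - y‖ ^ γ) (𝓝 y) (𝓝 0) := by
    have : ContinuousAt (fun x : Plane => B N * ‖x - y‖ ^ γ) y :=
      continuousAt_const.mul ((continuous_id.sub continuous_const).norm.continuousAt.rpow_const
        (Or.inr hγ.le))
    simpa [Real.zero_rpow hγ.ne'] using this.tendsto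
  refine squeeze_zero' (Eventually.of_forall fun _ => norm_nonneg _) ?_ hc
  filter_upwards [Metric.closedBall_mem_nhds y one_pos] with x hx
  rw [mem_closedBall_iff_norm] at hx
  have : ‖x‖ ≤ ‖y‖ + 1 := by
    have := norm_add_le (x - y) y
    rw [sub_add_cancel] at this
    linarith
  exact h N x y (this.trans hN) (by linarith) hx

end HolderLimit

/-! ### Almost sure bounds with a measurable constant. -/

section ChainingConstants

open Filter
open scoped ENNReal Topology

variable {Ω : Type*} [MeasurableSpace Ω] {P : Measure Ω}

/-- The bound 1 + Z dominates the 2m-th root of Z, so no roots of the random constant are needed. -/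
theorem abs_le_one_add_of_pow_le {t Z : ℝ} {m : ℕ} (hm : m ≠ 0) (hZ : 0 ≤ Z)
    (h : t ^ (2 * m) ≤ Z) : |t| ≤ 1 + Z := by
  by_contra hc
  push Not at hc
  have h1 : 1 ≤ |t| := by linarith
  have h2 : |t| ≤ |t| ^ (2 * m) := le_self_pow₀ h1 (by positivity)
  rw [Even.pow_abs ⟨m, two_mul m⟩] at h2
  linarith

/-- The Borel–Cantelli step of chaining for centered Gaussian variables. -/
theorem exists_ae_forall_abs_le {ι : Type*} {X : ℕ → ι → Ω → ℝ} {S : ℕ → Finset ι}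
    (hX : ∀ n i, Measurable (X n i)) (hG : ∀ n i, HasGaussianLaw (X n i) P)
    (h0 : ∀ n i, ∫ ω, X n i ω ∂P = 0) {V C r : ℝ} (hV : 0 ≤ V) (hr : 0 < r) (hr1 : r < 1)
    (hvar : ∀ n, ∀ i ∈ S n, Var[X n i; P] ≤ V * (r ^ 4) ^ n)
    (hcard : ∀ n, ((S n).card : ℝ) ≤ C * 4 ^ n) :
    ∃ A : Ω → ℝ, Measurable A ∧ (∀ ω, 0 ≤ A ω) ∧
      ∀ᵐ ω ∂P, ∀ n, ∀ i ∈ S n, |X n i ω| ≤ A ω * r ^ n := by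
  have hC : 0 ≤ C := by simpa using (Nat.cast_nonneg _).trans (hcard 0)
  -- After division by r^n the variance is at most V r^{2n}, so the moment of order 2m decays like
  -- (r^{2m})^n. A rate below 1/8 beats the C · 4^n indices and leaves a convergent geometric
  -- series.
  obtain ⟨m, hm⟩ : ∃ m : ℕ, (r ^ 2) ^ m < 1 / 8 :=
    exists_pow_lt_of_lt_one (by norm_num) (pow_lt_one₀ hr.le hr1 two_ne_zero)
  have hm0 : m ≠ 0 := by
    rintro rfl
    norm_num at hm
  obtain ⟨M, hM, hmom⟩ := exists_lintegral_pow_le (P := P) m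
  set f : ℕ → ι → Ω → ℝ≥0∞ := fun n i ω => ENNReal.ofReal ((X n i ω / r ^ n) ^ (2 * m)) with hf
  have hfm : ∀ n i, Measurable (f n i) := fun n i =>
    ENNReal.measurable_ofReal.comp (((hX n i).div_const _).pow_const _)
  -- A single random variable of finite mean dominates every normalized increment at once.
  set Z : Ω → ℝ≥0∞ := fun ω => ∑' n, ∑ i ∈ S n, f n i ω with hZ
  have hZm : Measurable Z :=
    Measurable.tsum fun n => Finset.measurable_fun_sum _ fun i _ => hfm n i
  have hbound : ∀ n, ∀ i ∈ S n, ∫⁻ ω, f n i ω ∂P ≤ M * ENNReal.ofReal (V ^ m * (1 / 8) ^ n) := by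
    intro n i hi
    have e : ∀ ω, f n i ω = ENNReal.ofReal (((r ^ n) ^ (2 * m))⁻¹) *
        ENNReal.ofReal (X n i ω ^ (2 * m)) := by
      intro ω
      rw [← ENNReal.ofReal_mul (by positivity), hf]
      simp only [div_pow]
      rw [div_eq_inv_mul]
    simp_rw [e]
    rw [lintegral_const_mul _ ((hX n i).pow_const _).ennreal_ofReal]
    calc _ ≤ ENNReal.ofReal (((r ^ n) ^ (2 * m))⁻¹) *
          (M * ENNReal.ofReal (V * (r ^ 4) ^ n) ^ m) := by
          gcongr
          exact hmom _ (hG n i) (h0 n i) _ (hvar n i hi)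
      _ = M * ENNReal.ofReal (V ^ m * ((r ^ 2) ^ m) ^ n) := by
          rw [← ENNReal.ofReal_pow (by positivity), mul_left_comm,
            ← ENNReal.ofReal_mul (by positivity)]
          congr 2
          rw [mul_pow, mul_left_comm]
          congr 1
          rw [inv_mul_eq_iff_eq_mul₀ (by positivity)]
          ring
      _ ≤ _ := by gcongr
  have hZint : ∫⁻ ω, Z ω ∂P ≠ ⊤ := by
    have hs : Summable fun n : ℕ => C * V ^ m * (1 / 2 : ℝ) ^ n :=
      (summable_geometric_of_lt_one (by norm_num) (by norm_num)).mul_left _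
    refine ne_top_of_le_ne_top (ENNReal.mul_ne_top hM hs.tsum_ofReal_ne_top) ?_
    rw [hZ, lintegral_tsum fun n => (Finset.measurable_fun_sum _ fun i _ => hfm n i).aemeasurable,
      ← ENNReal.tsum_mul_left]
    refine ENNReal.tsum_le_tsum fun n => ?_
    rw [lintegral_finsetSum _ fun i _ => hfm n i]
    calc _ ≤ ∑ i ∈ S n, M * ENNReal.ofReal (V ^ m * (1 / 8) ^ n) :=
          Finset.sum_le_sum fun i hi => hbound n i hi
      _ = M * (ENNReal.ofReal (S n).card * ENNReal.ofReal (V ^ m * (1 / 8) ^ n)) := by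
          rw [Finset.sum_const, nsmul_eq_mul, ENNReal.ofReal_natCast]
          ring
      _ ≤ M * ENNReal.ofReal (C * V ^ m * (1 / 2) ^ n) := by
          rw [← ENNReal.ofReal_mul (by positivity)]
          refine mul_le_mul_right (ENNReal.ofReal_le_ofReal ?_) M
          calc _ ≤ C * 4 ^ n * (V ^ m * (1 / 8) ^ n) := by gcongr; exact hcard n
            _ = C * V ^ m * (4 * (1 / 8)) ^ n := by rw [mul_pow]; ring
            _ = C * V ^ m * (1 / 2) ^ n := by norm_num
  refine ⟨fun ω => 1 + (Z ω).toReal, hZm.ennreal_toReal.const_add 1,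
    fun ω => by positivity, ?_⟩
  filter_upwards [ae_lt_top hZm hZint] with ω hω n i hi
  have h1 : f n i ω ≤ Z ω :=
    (Finset.single_le_sum (f := fun i => f n i ω) (fun _ _ => zero_le) hi).trans
      (ENNReal.le_tsum (f := fun n => ∑ i ∈ S n, f n i ω) n)
  have h2 : (X n i ω / r ^ n) ^ (2 * m) ≤ (Z ω).toReal :=
    (ENNReal.ofReal_le_iff_le_toReal hω.ne).1 h1
  have h3 := abs_le_one_add_of_pow_le hm0 ENNReal.toReal_nonneg h2
  rwa [abs_div, abs_of_pos (pow_pos hr n), div_le_iff₀ (pow_pos hr n)] at h3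

end ChainingConstants

/-! ### Countably many test functions determine a distribution. -/

section Separability

open Filter Topology
open scoped ENNReal Topology

/-- For functions vanishing off K the supremum over E is the supremum over K, so restriction is an
isometry. It replaces bounded functions on E, which need not form a separable space, by C(K, G). -/
theorem isInducing_restrict_of_compact {E : Type*} [NormedAddCommGroup E] (K : Compacts E)
    (G : Type*) [NormedAddCommGroup G] :
    IsInducing fun f : {f : BoundedContinuousFunction E G // ∀ x ∉ K, f x = 0} =>
      (f.1.toContinuousMap.restrict (K : Set E)) := by
  refine (Isometry.of_dist_eq fun f g => le_antisymm ?_ ?_).isUniformInducing.isInducing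
  · refine (ContinuousMap.dist_le dist_nonneg).2 fun x => ?_
    exact f.1.dist_coe_le_dist (g := g.1) x.1
  · refine (BoundedContinuousFunction.dist_le dist_nonneg).2 fun x => ?_
    by_cases hx : x ∈ K
    · exact ContinuousMap.dist_apply_le_dist
        (f := f.1.toContinuousMap.restrict (K : Set E))
        (g := g.1.toContinuousMap.restrict (K : Set E)) ⟨x, hx⟩
    · rw [f.2 x hx, g.2 x hx, dist_self]
      exact dist_nonneg

variable {E : Type*} [NormedAddCommGroup E] [NormedSpace ℝ E] [FiniteDimensional ℝ E]

instance ContinuousMultilinearMap.finiteDimensional_real (i : ℕ) :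
    FiniteDimensional ℝ (E [×i]→L[ℝ] ℝ) :=
  FiniteDimensional.of_injective
    { toFun := ContinuousMultilinearMap.toMultilinearMap
      map_add' := fun _ _ => rfl
      map_smul' := fun _ _ => rfl :
      (E [×i]→L[ℝ] ℝ) →ₗ[ℝ] MultilinearMap ℝ (fun _ : Fin i => E) ℝ }
    ContinuousMultilinearMap.toMultilinearMap_injective

/-- The topology is a countable infimum of those induced by the derivatives of each order. These
vanish off K and take values in a finite-dimensional space, so each induced topology comes from a
second countable space of continuous functions on K. -/
instance ContDiffMapSupportedIn.secondCountableTopology (K : Compacts E) :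
    SecondCountableTopology 𝓓_{K}(E, ℝ) := by
  refine secondCountableTopology_iInf fun i => ?_
  have hS : ∀ f : 𝓓_{K}(E, ℝ), ∀ x ∉ K,
      ContDiffMapSupportedIn.structureMapLM ℝ ⊤ i f x = 0 := by
    intro f x hx
    rw [ContDiffMapSupportedIn.structureMapLM_top_apply]
    exact f.iteratedFDeriv_zero_on_compl hx
  have e : TopologicalSpace.induced (ContDiffMapSupportedIn.structureMapLM ℝ ⊤ i) inferInstance =
      TopologicalSpace.induced (fun f : 𝓓_{K}(E, ℝ) =>
        (ContDiffMapSupportedIn.structureMapLM ℝ ⊤ i f).toContinuousMap.restrict (K : Set E))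
        inferInstance := by
    have h1 := congrArg (TopologicalSpace.induced fun f : 𝓓_{K}(E, ℝ) =>
      (⟨ContDiffMapSupportedIn.structureMapLM ℝ ⊤ i f, hS f⟩ :
        {f : BoundedContinuousFunction E (E [×i]→L[ℝ] ℝ) // ∀ x ∉ K, f x = 0}))
      (isInducing_restrict_of_compact K (E [×i]→L[ℝ] ℝ)).eq_induced
    rw [instTopologicalSpaceSubtype, induced_compose, induced_compose] at h1
    exact h1
  rw [e]
  have : SecondCountableTopology C(K, E [×i]→L[ℝ] ℝ) := inferInstance
  exact secondCountableTopology_induced _ _ _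

/-- A countable set of test functions that determines distributions. -/
theorem TestFunction.exists_countable_determining :
    ∃ s : Set 𝓓((⊤ : Opens E), ℝ), s.Countable ∧ ∀ S T : 𝓓((⊤ : Opens E), ℝ) → ℝ,
      Continuous S → Continuous T → (∀ φ ∈ s, S φ = T φ) → S = T := by
  have hK : ∀ n : ℕ, ∃ K : Compacts E, (K : Set E) = Metric.closedBall 0 n := fun n =>
    ⟨⟨_, isCompact_closedBall _ _⟩, rfl⟩
  choose K hK using hK
  have hsub : ∀ n, (K n : Set E) ⊆ ((⊤ : Opens E) : Set E) := fun n _ _ => trivial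
  refine ⟨⋃ n, TestFunction.ofSupportedIn (hsub n) '' Set.range (denseSeq 𝓓_{K n}(E, ℝ)), ?_, ?_⟩
  · exact Set.countable_iUnion fun n => (Set.countable_range _).image _
  · intro S T hS hT h
    ext φ
    obtain ⟨r, hr⟩ := φ.hasCompactSupport.isCompact.isBounded.subset_closedBall 0
    obtain ⟨n, hn⟩ := exists_nat_ge r
    have hφ : Function.support φ ⊆ K n := by
      rw [hK]
      exact (subset_tsupport _).trans (hr.trans (Metric.closedBall_subset_closedBall hn))
    -- Density is used only on functions supported in one fixed ball, and every test function lies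
    -- in such a space.
    have h1 : S ∘ TestFunction.ofSupportedIn (hsub n) = T ∘ TestFunction.ofSupportedIn (hsub n) := by
      refine (denseRange_denseSeq _).equalizer
        (hS.comp (TestFunction.continuous_ofSupportedIn _))
        (hT.comp (TestFunction.continuous_ofSupportedIn _)) ?_
      ext k
      exact h _ (Set.mem_iUnion.2 ⟨n, Set.mem_image_of_mem _ (Set.mem_range_self k)⟩)
    exact congrFun h1 (ContDiffMapSupportedIn.of_support_subset φ.contDiff hφ)

end Separability

/-! ### Hölder regularity of the Gaussian field by chaining. -/

section GaussianRegularity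

open Filter
open scoped ENNReal Topology

variable {Ω : Type*} [MeasurableSpace Ω] {P : Measure Ω}
  {lam : Ω → 𝓓'((⊤ : Opens Plane), ℝ)} {σ : Plane → Plane → ℂ} {m C K β : ℝ}

theorem integral_abs_sub_le (φ ψ : 𝓓((⊤ : Opens Plane), ℝ)) :
    ∫ x, |(φ - ψ) x| ≤ (∫ x, |φ x|) + ∫ x, |ψ x| := by
  rw [← integral_add φ.integrable_plane.abs ψ.integrable_plane.abs]
  refine integral_mono (φ - ψ).integrable_plane.abs
    (φ.integrable_plane.abs.add ψ.integrable_plane.abs) fun x => ?_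
  rw [sub_apply]
  exact abs_sub _ _

/-- The difference has L¹ norm at most 2 and pairs with the kernel to at most K(1 + 1 + 2) times the
Hölder scale: one from each bump and two from the distance of their centres. -/
theorem variance_mollifier_sub_le (hm : m < -2) (hc : ∀ x, Continuous (σ x))
    (hσ : ∀ x ξ, ‖σ x ξ‖ ≤ C * (1 + ‖ξ‖) ^ m)
    (h_gauss : IsGaussianField P lam) (hcov : HasCovarianceSymbol P lam σ)
    (hK : 0 ≤ K) (hβ : 0 < β) (hβ1 : β ≤ 1)
    (hh : ∀ x y y', ‖covKernel σ x y - covKernel σ x y'‖ ≤ K * ‖y - y'‖ ^ β)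
    {n n' : ℕ} (hn : n ≤ n') {a b : Plane} (hab : ‖a - b‖ ≤ 2 * (1 / 2 : ℝ) ^ n) :
    Var[fun ω => lam ω (mollifier n' a - mollifier n b); P] ≤ 8 * K * ((1 / 2 : ℝ) ^ n) ^ β := by
  have hp : (0 : ℝ) < (1 / 2) ^ n := by positivity
  have h1 : ‖a - b‖ ^ β ≤ 2 * ((1 / 2 : ℝ) ^ n) ^ β := by
    calc _ ≤ (2 * (1 / 2 : ℝ) ^ n) ^ β := by gcongr
      _ = 2 ^ β * ((1 / 2 : ℝ) ^ n) ^ β := Real.mul_rpow (by norm_num) hp.le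
      _ ≤ _ := by
          gcongr
          calc (2 : ℝ) ^ β ≤ 2 ^ (1 : ℝ) := Real.rpow_le_rpow_of_exponent_le (by norm_num) hβ1
            _ = 2 := Real.rpow_one 2
  have h2 : ((1 / 2 : ℝ) ^ n') ^ β ≤ ((1 / 2 : ℝ) ^ n) ^ β := by
    refine Real.rpow_le_rpow (by positivity) ?_ hβ.le
    exact pow_le_pow_of_le_one (by norm_num) (by norm_num) hn
  have h3 : ∫ x, |(mollifier n' a - mollifier n b) x| ≤ 2 := by
    refine (integral_abs_sub_le _ _).trans ?_
    rw [integral_abs_mollifier, integral_abs_mollifier]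
    norm_num
  refine (variance_le_of_norm_integral_covKernel_le hm hc hσ h_gauss hcov _
    (B := K * (4 * ((1 / 2 : ℝ) ^ n) ^ β)) fun x => ?_).trans ?_
  · refine (norm_integral_mul_mollifier_sub_mollifier_le hK hβ (hh x) n' n a b).trans ?_
    gcongr
    linarith
  · calc _ ≤ 2 * (K * (4 * ((1 / 2 : ℝ) ^ n) ^ β)) := by gcongr
      _ = _ := by ring

theorem norm_gridPoint_add_sub_le (n : ℕ) (j : ℤ × ℤ) {e : ℤ × ℤ} (he : e ∈ gridNeighbours) :
    ‖gridPoint n (j + e) - gridPoint n j‖ ≤ 2 * (1 / 2 : ℝ) ^ n := by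
  obtain ⟨h1, h2⟩ := Finset.mem_product.1 he
  rw [Finset.mem_Icc] at h1 h2
  refine (norm_gridPoint_sub_le n _ _).trans ?_
  have key : ∀ i t : ℤ, -1 ≤ t ∧ t ≤ 1 → |((i + t : ℤ) : ℝ) - i| ≤ 1 := by
    intro i t ht
    push_cast
    rw [add_sub_cancel_left, abs_le]
    exact ⟨by exact_mod_cast ht.1, by exact_mod_cast ht.2⟩
  have k1 := key j.1 e.1 h1
  have k2 := key j.2 e.2 h2
  gcongr
  simp only [Prod.fst_add, Prod.snd_add]
  linarith

theorem norm_gridPoint_succ_sub_le (n : ℕ) (j : ℤ × ℤ) {e : ℤ × ℤ} (he : e ∈ gridNeighbours) :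
    ‖gridPoint (n + 1) (2 * j.1 + e.1, 2 * j.2 + e.2) - gridPoint n j‖ ≤
      2 * (1 / 2 : ℝ) ^ n := by
  rw [← gridPoint_succ n j]
  refine (norm_gridPoint_add_sub_le (n + 1) (2 * j.1, 2 * j.2) he).trans ?_
  gcongr 2 * ?_
  exact pow_le_pow_of_le_one (by norm_num) (by norm_num) n.le_succ

theorem half_pow_rpow_eq (γ : ℝ) (n : ℕ) :
    ((1 / 2 : ℝ) ^ n) ^ (4 * γ) = (((1 / 2 : ℝ) ^ γ) ^ 4) ^ n := by
  rw [← Real.rpow_natCast, ← Real.rpow_natCast, ← Real.rpow_natCast, ← Real.rpow_mul (by positivity),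
    ← Real.rpow_mul (by positivity), ← Real.rpow_mul (by positivity)]
  congr 1
  push_cast
  ring

theorem half_rpow_lt_one {γ : ℝ} (hγ : 0 < γ) : (1 / 2 : ℝ) ^ γ < 1 :=
  Real.rpow_lt_one (by norm_num) (by norm_num) hγ

/-- Grid increments of a Gaussian field with Hölder covariance kernel. -/
theorem exists_ae_abs_mollifier_sub_le {γ : ℝ} (hm : m < -2) (hc : ∀ x, Continuous (σ x))
    (hσ : ∀ x ξ, ‖σ x ξ‖ ≤ C * (1 + ‖ξ‖) ^ m)
    (h_gauss : IsGaussianField P lam) (h_mean : ∀ φ, ∫ ω, lam ω φ ∂P = 0)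
    (hcov : HasCovarianceSymbol P lam σ)
    (hK : 0 ≤ K) (hγ : 0 < γ) (hγ1 : 4 * γ ≤ 1)
    (hh : ∀ x y y', ‖covKernel σ x y - covKernel σ x y'‖ ≤ K * ‖y - y'‖ ^ (4 * γ))
    (u : ℕ → ℕ) (hu : ∀ n, n ≤ u n) (v : ℤ × ℤ → ℤ × ℤ → ℤ × ℤ)
    (hv : ∀ n j, ∀ e ∈ gridNeighbours,
      ‖gridPoint (u n) (v j e) - gridPoint n j‖ ≤ 2 * (1 / 2 : ℝ) ^ n) (N : ℕ) :
    ∃ A : Ω → ℝ, Measurable A ∧ (∀ ω, 0 ≤ A ω) ∧ ∀ᵐ ω ∂P, ∀ n, ∀ j ∈ gridBox N n,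
      ∀ e ∈ gridNeighbours,
      |lam ω (mollifier (u n) (gridPoint (u n) (v j e))) - lam ω (mollifier n (gridPoint n j))| ≤
        A ω * ((1 / 2 : ℝ) ^ γ) ^ n := by
  have hvar : ∀ n, ∀ i ∈ gridBox N n ×ˢ gridNeighbours, Var[fun ω => lam ω (mollifier (u n)
      (gridPoint (u n) (v i.1 i.2)) - mollifier n (gridPoint n i.1)); P] ≤
      8 * K * (((1 / 2 : ℝ) ^ γ) ^ 4) ^ n := by
    intro n i hi
    obtain ⟨h1, h2⟩ := Finset.mem_product.1 hi
    rw [← half_pow_rpow_eq]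
    exact variance_mollifier_sub_le hm hc hσ h_gauss hcov hK (by positivity) hγ1 hh (hu n)
      (hv n _ _ h2)
  have hcard : ∀ n, ((gridBox N n ×ˢ gridNeighbours).card : ℝ) ≤ 9 * (2 * N + 1) ^ 2 * 4 ^ n := by
    intro n
    have h9 : gridNeighbours.card = 9 := by
      rw [gridNeighbours, Finset.card_product, Int.card_Icc]
      rfl
    rw [Finset.card_product, h9]
    push_cast
    linarith [card_gridBox_le N n]
  obtain ⟨A, hA, hA0, h⟩ := exists_ae_forall_abs_le (P := P)
    (X := fun n (i : (ℤ × ℤ) × (ℤ × ℤ)) ω =>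
      lam ω (mollifier (u n) (gridPoint (u n) (v i.1 i.2)) - mollifier n (gridPoint n i.1)))
    (S := fun n => gridBox N n ×ˢ gridNeighbours) (V := 8 * K) (C := 9 * (2 * N + 1) ^ 2)
    (fun n i => h_gauss.measurable _) (fun n i => h_gauss.gaussian.hasGaussianLaw_eval _)
    (fun n i => h_mean _) (by positivity) (Real.rpow_pos_of_pos (by norm_num) γ)
    (half_rpow_lt_one hγ) hvar hcard
  refine ⟨A, hA, hA0, ?_⟩
  filter_upwards [h] with ω hω n j hj e he
  have := hω n (j, e) (Finset.mk_mem_product hj he)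
  rwa [map_sub] at this

/-- The variance of the error decays geometrically, so the chaining bound applies with a single
variable at each level. -/
theorem ae_tendsto_sub_gridApprox {γ : ℝ} (hm : m < -2) (hc : ∀ x, Continuous (σ x))
    (hσ : ∀ x ξ, ‖σ x ξ‖ ≤ C * (1 + ‖ξ‖) ^ m)
    (h_gauss : IsGaussianField P lam) (h_mean : ∀ φ, ∫ ω, lam ω φ ∂P = 0)
    (hcov : HasCovarianceSymbol P lam σ)
    (hK : 0 ≤ K) (hγ : 0 < γ) (hγ1 : 4 * γ ≤ 1)
    (hh : ∀ x y y', ‖covKernel σ x y - covKernel σ x y'‖ ≤ K * ‖y - y'‖ ^ (4 * γ))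
    {φ : 𝓓((⊤ : Opens Plane), ℝ)} {N : ℕ} (hφ : ∀ x, φ x ≠ 0 → ‖x‖ ≤ N) :
    ∀ᵐ ω ∂P, Tendsto (fun n => lam ω (φ - gridApprox n (gridBox N n) φ)) atTop (𝓝 0) := by
  have hJ : ∀ n x, φ x ≠ 0 → gridIndex n x ∈ gridBox N n := fun n x hx =>
    gridIndex_mem_gridBox (hφ x hx) n
  set I := ∫ x, |φ x| with hI
  have hI0 : 0 ≤ I := integral_nonneg fun x => abs_nonneg _
  have hr : (0 : ℝ) < (1 / 2 : ℝ) ^ γ := Real.rpow_pos_of_pos (by norm_num) γ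
  have hvar : ∀ n, ∀ i ∈ ({()} : Finset Unit),
      Var[fun ω => lam ω (φ - gridApprox n (gridBox N n) φ); P] ≤
        2 * I * (3 * K * I) * (((1 / 2 : ℝ) ^ γ) ^ 4) ^ n := by
    intro n _ _
    rw [← half_pow_rpow_eq]
    refine (variance_le_of_norm_integral_covKernel_le hm hc hσ h_gauss hcov _ fun x =>
      norm_integral_mul_sub_gridApprox_le (hJ n) hK (by positivity) hγ1 (hh x)).trans ?_
    calc _ ≤ 2 * I * (3 * K * ((1 / 2 : ℝ) ^ n) ^ (4 * γ) * I) := by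
          gcongr
          refine (integral_abs_sub_le _ _).trans ?_
          linarith [integral_abs_gridApprox_le (hJ n)]
      _ = _ := by ring
  have hcard : ∀ n, ((({()} : Finset Unit).card : ℕ) : ℝ) ≤ 1 * 4 ^ n := by
    intro n
    simpa using one_le_pow₀ (M₀ := ℝ) (n := n) (a := 4) (by norm_num)
  obtain ⟨A, -, -, h⟩ := exists_ae_forall_abs_le (P := P)
    (X := fun n (_ : Unit) ω => lam ω (φ - gridApprox n (gridBox N n) φ))
    (S := fun _ => {()}) (V := 2 * I * (3 * K * I)) (C := 1)
    (fun n i => h_gauss.measurable _) (fun n i => h_gauss.gaussian.hasGaussianLaw_eval _)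
    (fun n i => h_mean _) (by positivity) hr (half_rpow_lt_one hγ) hvar hcard
  filter_upwards [h] with ω hω
  refine squeeze_zero_norm (fun n => hω n () (Finset.mem_singleton_self _)) ?_
  have := (tendsto_pow_atTop_nhds_zero_of_lt_one hr.le (half_rpow_lt_one hγ)).const_mul (A ω)
  rwa [mul_zero] at this

/-- Applied to the approximation, T integrates φ against the step function of its mollified values,
which is uniformly close to ℓ on the support of φ. -/
theorem tendsto_gridApprox (T : 𝓓'((⊤ : Opens Plane), ℝ)) {ℓ : Plane → ℝ} (hℓ : Continuous ℓ)
    {φ : 𝓓((⊤ : Opens Plane), ℝ)} {N : ℕ} (hφ : ∀ x, φ x ≠ 0 → ‖x‖ ≤ N) {b : ℕ → ℝ}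
    (hb : Tendsto b atTop (𝓝 0))
    (h : ∀ n x, ‖x‖ ≤ N → |T (mollifier n (gridPoint n (gridIndex n x))) - ℓ x| ≤ b n) :
    Tendsto (fun n => T (gridApprox n (gridBox N n) φ)) atTop (𝓝 (∫ x, ℓ x * φ x)) := by
  have hJ : ∀ n x, φ x ≠ 0 → gridIndex n x ∈ gridBox N n := fun n x hx =>
    gridIndex_mem_gridBox (hφ x hx) n
  have hi : Integrable fun x => ℓ x * φ x :=
    (hℓ.mul φ.continuous).integrable_of_hasCompactSupport φ.hasCompactSupport.mul_left
  refine tendsto_iff_norm_sub_tendsto_zero.2 (squeeze_zero (fun _ => norm_nonneg _)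
    (g := fun n => b n * ∫ x, |φ x|) (fun n => ?_) (by simpa using hb.mul_const _))
  obtain ⟨i1, e1⟩ := integral_smul_comp_gridIndex φ.integrable_plane n (hJ n)
    fun j => T (mollifier n (gridPoint n j))
  have e2 : T (gridApprox n (gridBox N n) φ) =
      ∫ x, φ x • T (mollifier n (gridPoint n (gridIndex n x))) := by
    rw [e1, gridApprox, map_sum]
    exact Finset.sum_congr rfl fun j _ => map_smul _ _ _
  rw [e2, ← integral_sub i1 hi, ← integral_const_mul]
  refine norm_integral_le_of_norm_le (φ.integrable_plane.abs.const_mul _)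
    (Eventually.of_forall fun x => ?_)
  rw [smul_eq_mul, mul_comm (ℓ x), ← mul_sub, norm_mul, mul_comm, Real.norm_eq_abs, Real.norm_eq_abs]
  by_cases hx : φ x = 0
  · simp [hx]
  · gcongr
    exact h n x (hφ x hx)

theorem continuous_integral_mul {ℓ : Plane → ℝ} (hℓ : Continuous ℓ) :
    Continuous fun φ : 𝓓((⊤ : Opens Plane), ℝ) => ∫ x, ℓ x * φ x := by
  have e : (fun φ : 𝓓((⊤ : Opens Plane), ℝ) => ∫ x, ℓ x * φ x) =
      TestFunction.integralAgainstBilinCLM (ContinuousLinearMap.mul ℝ ℝ) volume ℓ := by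
    ext φ
    rw [TestFunction.integralAgainstBilinCLM_eq_integral (hℓ.locallyIntegrable.locallyIntegrableOn _)]
    simp [mul_comm]
  rw [e]
  exact ContinuousLinearMap.continuous _

theorem TestFunction.exists_norm_le (φ : 𝓓((⊤ : Opens Plane), ℝ)) :
    ∃ N : ℕ, ∀ x, φ x ≠ 0 → ‖x‖ ≤ N := by
  obtain ⟨r, hr⟩ := φ.hasCompactSupport.isCompact.isBounded.exists_norm_le
  obtain ⟨N, hN⟩ := exists_nat_ge r
  exact ⟨N, fun x hx => (hr x (subset_tsupport _ hx)).trans hN⟩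

/-- A centered Gaussian field whose covariance symbol has order below `-2` is almost surely a
locally Hölder continuous function, with measurable local Hölder constants. -/
theorem exists_ae_holder_representative {γ : ℝ} (hm : m + 4 * γ < -2)
    (hc : ∀ x, Continuous (σ x)) (hC : 0 ≤ C)
    (hσ : ∀ x ξ, ‖σ x ξ‖ ≤ C * (1 + ‖ξ‖) ^ m)
    (h_gauss : IsGaussianField P lam) (h_mean : ∀ φ, ∫ ω, lam ω φ ∂P = 0)
    (hcov : HasCovarianceSymbol P lam σ) (hγ : 0 < γ) (hγ1 : 4 * γ ≤ 1) :
    ∃ A : ℕ → Ω → ℝ, (∀ N, Measurable (A N)) ∧ (∀ N ω, 0 ≤ A N ω) ∧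
      ∀ᵐ ω ∂P, ∃ ℓ : Plane → ℝ, IsContinuousRepresentative (lam ω) ℓ ∧
        (∀ (N : ℕ) (x : Plane), ‖x‖ ≤ N → |ℓ x| ≤ A N ω) ∧
        (∀ (N : ℕ) (x y : Plane), ‖x‖ ≤ N → ‖y‖ ≤ N → ‖x - y‖ ≤ 1 →
          |ℓ x - ℓ y| ≤ A N ω * ‖x - y‖ ^ γ) := by
  have hm2 : m < -2 := by linarith
  obtain ⟨K, hK, hh⟩ := exists_covKernel_holder hm2 hc hC hσ (by positivity : 0 < 4 * γ) hγ1 hm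
  -- Increments between neighbours on one level; the second application, with the successor level,
  -- controls refinement of the grid.
  choose A₁ hA₁ hA₁0 h₁ using exists_ae_abs_mollifier_sub_le hm2 hc hσ h_gauss h_mean hcov hK hγ
    hγ1 hh id (fun n => le_rfl) (fun j e => j + e)
    (fun n j e he => norm_gridPoint_add_sub_le n j he)
  choose A₂ hA₂ hA₂0 h₂ using exists_ae_abs_mollifier_sub_le hm2 hc hσ h_gauss h_mean hcov hK hγ
    hγ1 hh Nat.succ Nat.le_succ (fun j e => (2 * j.1 + e.1, 2 * j.2 + e.2))
    (fun n j e he => norm_gridPoint_succ_sub_le n j he)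
  -- The last sum bounds the values on the coarsest grid. The constant is a finite expression in
  -- measurable pairings, so measurability of ℓ in ω is never needed.
  set A : ℕ → Ω → ℝ := fun N ω => A₁ N ω + A₂ N ω +
    ∑ j ∈ gridBox N 0, |lam ω (mollifier 0 (gridPoint 0 j))| with hA
  have hA0 : ∀ N ω, 0 ≤ A N ω := fun N ω =>
    add_nonneg (add_nonneg (hA₁0 N ω) (hA₂0 N ω)) (Finset.sum_nonneg fun _ _ => abs_nonneg _)
  have hAm : ∀ N, Measurable (A N) := fun N => ((hA₁ N).add (hA₂ N)).add
    (Finset.measurable_fun_sum _ fun j _ => (h_gauss.measurable _).abs)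
  set r := (1 / 2 : ℝ) ^ γ with hr
  have hr0 : 0 < r := Real.rpow_pos_of_pos (by norm_num) γ
  have hr1 : 0 < 1 - r := sub_pos.2 (half_rpow_lt_one hγ)
  obtain ⟨s, hs, hdet⟩ := TestFunction.exists_countable_determining (E := Plane)
  choose Nφ hNφ using TestFunction.exists_norm_le
  have h₃ : ∀ᵐ ω ∂P, ∀ φ ∈ s,
      Tendsto (fun n => lam ω (φ - gridApprox n (gridBox (Nφ φ) n) φ)) atTop (𝓝 0) :=
    (ae_ball_iff hs).2 fun φ _ => ae_tendsto_sub_gridApprox hm2 hc hσ h_gauss h_mean hcov hK hγ hγ1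
      hh (hNφ φ)
  refine ⟨fun N ω => A N ω * (2 + 4 * (1 - r)⁻¹), fun N => (hAm N).mul_const _,
    fun N ω => mul_nonneg (hA0 N ω) (by positivity), ?_⟩
  filter_upwards [ae_all_iff.2 h₁, ae_all_iff.2 h₂, h₃] with ω w₁ w₂ w₃
  have f₀ : ∀ N, ∀ j ∈ gridBox N 0, |lam ω (mollifier 0 (gridPoint 0 j))| ≤ A N ω := by
    intro N j hj
    have h := Finset.single_le_sum (f := fun j => |lam ω (mollifier 0 (gridPoint 0 j))|)
      (fun _ _ => abs_nonneg _) hj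
    have := hA₁0 N ω
    have := hA₂0 N ω
    simp only [hA]
    linarith
  have f₁ : ∀ N n, ∀ j ∈ gridBox N n, ∀ e ∈ gridNeighbours,
      |lam ω (mollifier n (gridPoint n (j + e))) - lam ω (mollifier n (gridPoint n j))| ≤
        A N ω * r ^ n := by
    intro N n j hj e he
    refine (w₁ N n j hj e he).trans ?_
    gcongr
    have := hA₂0 N ω
    have := Finset.sum_nonneg (s := gridBox N 0)
      (fun j _ => abs_nonneg (lam ω (mollifier 0 (gridPoint 0 j))))
    simp only [hA]
    linarith
  have f₂ : ∀ N n, ∀ j ∈ gridBox N n, ∀ e ∈ gridNeighbours,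
      |lam ω (mollifier (n + 1) (gridPoint (n + 1) (2 * j.1 + e.1, 2 * j.2 + e.2))) -
        lam ω (mollifier n (gridPoint n j))| ≤ A N ω * r ^ n := by
    intro N n j hj e he
    refine (w₂ N n j hj e he).trans ?_
    gcongr
    have := hA₁0 N ω
    have := Finset.sum_nonneg (s := gridBox N 0)
      (fun j _ => abs_nonneg (lam ω (mollifier 0 (gridPoint 0 j))))
    simp only [hA]
    linarith
  obtain ⟨ℓ, l₁, l₂, l₃⟩ := exists_holder_limit
    (F := fun n j => lam ω (mollifier n (gridPoint n j))) (A := fun N => A N ω) hγ (by linarith)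
    (fun N => hA0 N ω) f₀ f₁ f₂
  have hcont : Continuous ℓ := continuous_of_locally_holder hγ l₃
  refine ⟨ℓ, ⟨hcont, fun φ => ?_⟩, fun N x hx => (l₂ N x hx).trans ?_, l₃⟩
  · refine congrFun (hdet _ _ (lam ω).continuous (continuous_integral_mul hcont) ?_) φ
    intro φ hφ
    have t1 := tendsto_gridApprox (lam ω) hcont (hNφ φ)
      (b := fun n => A (Nφ φ) ω * r ^ n / (1 - r)) ?_ (fun n x hx => l₁ _ n x hx)
    · have t2 := t1.add (w₃ φ hφ)
      simp only [map_sub, add_sub_cancel, add_zero] at t2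
      exact tendsto_nhds_unique tendsto_const_nhds t2
    · have := ((tendsto_pow_atTop_nhds_zero_of_lt_one hr0.le (half_rpow_lt_one hγ)).const_mul
        (A (Nφ φ) ω)).div_const (1 - r)
      rwa [mul_zero, zero_div] at this
  · have := hA0 N ω
    have : 0 ≤ (1 - r)⁻¹ := by positivity
    gcongr <;> linarith

end GaussianRegularity

/-! ### Vanishing of the representative off the support. -/

section Support

open Filter
open scoped ENNReal Topology

/-- Near a point off the support the distribution kills a narrow bump, yet that bump averages ℓ to
within |ℓ x|/2 of ℓ x. -/
theorem HalfSpaceScattering.IsContinuousRepresentative.eq_zero_of_notMem_dsupport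
    {T : 𝓓'((⊤ : Opens Plane), ℝ)} {ℓ : Plane → ℝ} (h : IsContinuousRepresentative T ℓ)
    {x : Plane} (hx : x ∉ Distribution.dsupport T) : ℓ x = 0 := by
  obtain ⟨s, hs, hso, hxs⟩ := (Distribution.notMem_dsupport_iff x).1 hx
  by_contra hne
  obtain ⟨δ, hδ, hδs⟩ := Metric.isOpen_iff.1 hso x hxs
  obtain ⟨δ', hδ', hδℓ⟩ := Metric.continuousAt_iff.1 (h.1.continuousAt (x := x)) (|ℓ x| / 2)
    (half_pos (abs_pos.2 hne))
  obtain ⟨n, hn⟩ := exists_pow_lt_of_lt_one (lt_min hδ hδ') (by norm_num : (1 / 2 : ℝ) < 1)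
  have h0 : T (mollifier n x) = 0 := by
    refine hs _ fun y hy => hδs ?_
    have h1 : tsupport (mollifier n x) ⊆ Metric.closedBall x ((1 / 2 : ℝ) ^ n) :=
      closure_minimal (fun y hy => by
        rw [mem_closedBall_iff_norm]
        exact (norm_sub_lt_of_mollifier_ne_zero hy).le) Metric.isClosed_closedBall
    exact Metric.closedBall_subset_ball (hn.trans_le (min_le_left _ _)) (h1 hy)
  rw [h.2] at h0
  have hi : Integrable fun y => ℓ y * mollifier n x y :=
    (h.1.mul (mollifier n x).continuous).integrable_of_hasCompactSupport
      (mollifier n x).hasCompactSupport.mul_left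
  have h2 : ℓ x = ∫ y, (ℓ x * mollifier n x y - ℓ y * mollifier n x y) := by
    rw [integral_sub ((mollifier n x).integrable_plane.const_mul _) hi, h0, integral_const_mul,
      integral_mollifier, mul_one, sub_zero]
  have h3 : ‖∫ y, (ℓ x * mollifier n x y - ℓ y * mollifier n x y)‖ ≤
      ∫ y, |ℓ x| / 2 * mollifier n x y := by
    refine norm_integral_le_of_norm_le ((mollifier n x).integrable_plane.const_mul _)
      (Eventually.of_forall fun y => ?_)
    rw [← sub_mul, norm_mul, Real.norm_of_nonneg (mollifier_nonneg n x y)]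
    by_cases hy : mollifier n x y = 0
    · simp [hy]
    · refine mul_le_mul_of_nonneg_right ?_ (mollifier_nonneg n x y)
      have h4 : dist y x < δ' := by
        rw [dist_eq_norm]
        exact (norm_sub_lt_of_mollifier_ne_zero hy).trans (hn.trans_le (min_le_right _ _))
      rw [norm_sub_rev]
      exact (hδℓ h4).le
  rw [← h2, integral_const_mul, integral_mollifier, Real.norm_eq_abs] at h3
  linarith [abs_pos.2 hne]

/-- A surjective linear map is open. Openness upgrades disjointness from D to disjointness from its
closure, where the support of the field lies. -/
theorem isOpen_proj_image {U : Set Space} (hU : IsOpen U) : IsOpen (proj '' U) := by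
  let f : Space →ₗ[ℝ] Plane :=
    { toFun := proj
      map_add' := fun x y => by ext i; fin_cases i <;> simp [proj]
      map_smul' := fun c x => by ext i; fin_cases i <;> simp [proj] }
  refine LinearMap.isOpenMap_of_finiteDimensional f (fun w => ⟨!₂[w 0, w 1, 0], ?_⟩) U hU
  ext i
  fin_cases i <;> simp [f, proj]

end Support

theorem corollary4p8 {Ω : Type*} [MeasurableSpace Ω] (P : Measure Ω) [IsProbabilityMeasure P]
    (D : Set Plane) (hD_open : IsOpen D) (hD_bdd : Bornology.IsBounded D)
    (U : Set Space) (hU_open : IsOpen U) (hU_bdd : Bornology.IsBounded U)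
    (hU : U ⊆ upperHalfSpace) (hUD : Disjoint (proj '' U) D)
    (lam : Ω → 𝓓'((⊤ : Opens Plane), ℝ)) (h_gauss : IsGaussianField P lam)
    (h_mean : ∀ φ : 𝓓((⊤ : Opens Plane), ℝ), ∫ ω, lam ω φ ∂P = 0)
    (h_supp : ∀ᵐ ω ∂P, Distribution.dsupport (lam ω) ⊆ closure D)
    (ε p : ℝ) (hε : 0 < ε) (hp : ε + 1 / 2 < p)
    (h_aniso : IsMicrolocallyAnisotropic P lam ε D) :
    ∃ C₁ C₂ k₀ : Ω → ℝ, Measurable C₁ ∧ Measurable C₂ ∧ Measurable k₀ ∧ (∀ ω, 1 ≤ k₀ ω) ∧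
      ∀ᵐ ω ∂P, ∃ ℓ : Plane → ℝ, IsContinuousRepresentative (lam ω) ℓ ∧
        (∀ k : ℝ, 1 ≤ k → ∀ y ∈ U, ∀ n : ℕ,
          MemLp (bornDensity D ℓ p k y n) 2 (volume.restrict D)) ∧
        (∀ k : ℝ, 1 ≤ k → ∀ n : ℕ, 1 ≤ n → ∀ x ∈ U, ∀ y ∈ U,
          ‖bornTerm D ℓ p k x y n‖ ≤
            C₁ ω * C₂ ω ^ (n - 1) * k ^ (-((n : ℝ) - 1) / 2 - n * p)) ∧
        (∀ k : ℝ, k₀ ω ≤ k → ∀ y ∈ U,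
          ∃ φ : Lp ℂ 2 (volume.restrict D),
            SolvesBoundaryEquation D ℓ p k y φ ∧
            (∀ ψ : Lp ℂ 2 (volume.restrict D), SolvesBoundaryEquation D ℓ p k y ψ → ψ = φ) ∧
            ∀ x ∈ U,
              HasSum (fun n : ℕ => bornTerm D ℓ p k x y (n + 1)) (singleLayer D k φ x) ∧
              (x ≠ y → HasSum (fun n : ℕ => bornTerm D ℓ p k x y n)
                (uIn k x y + singleLayer D k φ x))) := by
  obtain ⟨b, σ, -, -, -, ⟨hσ, -⟩, hcov⟩ := h_aniso
  -- Chaining uses a covariance kernel of Hölder exponent 4γ, which must be at most 1 and satisfy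
  -- -2ε - 2 + 4γ < -2; the choice 4γ = min(ε, 1) meets both.
  set γ : ℝ := min ε 1 / 4 with hγ_def
  have hmin : 0 < min ε 1 := lt_min hε one_pos
  have hγ : 0 < γ := by positivity
  have hγε : 4 * γ ≤ ε := by
    rw [hγ_def]
    linarith [min_le_left ε 1]
  have hγ1 : 4 * γ ≤ 1 := by
    rw [hγ_def]
    linarith [min_le_right ε 1]
  obtain ⟨C, hC, hσC⟩ := hσ.exists_norm_le
  obtain ⟨A, hAm, hA0, hA⟩ := exists_ae_holder_representative (γ := γ) (m := -2 * ε - 2)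
    (by linarith) hσ.continuous_right hC hσC h_gauss h_mean hcov hγ hγ1
  obtain ⟨R, -, hRD, hRU⟩ := exists_radius hD_bdd hU_bdd
  obtain ⟨N, hN⟩ := exists_nat_ge R
  obtain ⟨c₁, c₂, -, -, hborn⟩ :=
    born_series_of_holder hD_open hD_bdd hU_bdd hU hUD hγ (p := p) (by linarith)
  refine ⟨fun ω => c₁ * A N ω, fun ω => c₂ * A N ω, fun ω => max 1 (2 * (c₂ * A N ω)),
    (hAm N).const_mul _, (hAm N).const_mul _,
    measurable_const.max (((hAm N).const_mul _).const_mul _), fun ω => le_max_left _ _, ?_⟩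
  filter_upwards [hA, h_supp] with ω ⟨ℓ, hℓ, hsup, hhol⟩ hsuppω
  refine ⟨ℓ, hℓ, hborn ℓ hℓ.1 (A N ω) (hA0 N ω) (fun z hz => hsup N z ((hRD z hz).le.trans hN)) ?_⟩
  intro z hz x hx
  have hzN := (hRD z hz).le.trans hN
  have hxN := (hRU x hx).le.trans hN
  have hx0 : ℓ (proj x) = 0 := hℓ.eq_zero_of_notMem_dsupport fun h =>
    (hUD.closure_right (isOpen_proj_image hU_open)).le_bot
      ⟨Set.mem_image_of_mem _ hx, hsuppω h⟩
  -- The Hölder bound covers distances up to 1; beyond that the supremum bound suffices, since the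
  -- power of the distance is at least 1.
  rcases le_total ‖z - proj x‖ 1 with h1 | h1
  · have := hhol N z (proj x) hzN hxN h1
    rwa [hx0, sub_zero] at this
  · exact (hsup N z hzN).trans (le_mul_of_one_le_right (hA0 N ω) (Real.one_le_rpow h1 hγ.le))
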